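/- **Setting.** Let $\mathcal X,\mathcal A$ be countable, $H\ge 1$, and let $d_1$ be an initial distribution on $\mathcal X$. A *model* is a sequence $M=(M_h)_{h=1}^H$ of conditional densities $M_h(r,x'\mid x,a)$ of reward and next state, with respect to a fixed product of a $\sigma$-finite measure on $\mathbb R$ and counting measure on $\mathcal X$. Rewards lie in $[0,1]$, and rewards are normalized: the total reward of a trajectory started at any layer and state lies in $[0,1]$ almost surely, whatever the policy. Let $\mathcal M=\{\mathcal M_h\}_{h=1}^H$ with each $\mathcal M_h$ a finite set of layer models; its models are all $M=(M_h)_h$ with $M_h\in\mathcal M_h$, each of them normalized, so $|\mathcal M|=\prod_h|\mathcal M_h|$, and put $|\mathcal M|_\infty=\max_h|\mathcal M_h|\le|\mathcal M|$. Every $M\in\mathcal M$ has an optimal deterministic policy $\pi^\star_M$, i.e. one that maximizes $V^\pi_h(x)$ for all $h,x$; $\Pi=\{\pi^\star_M: M\in\mathcal M\}$. The data come from the MDP with model $M^\star$; $J(\pi)$ is the expected total reward and $d^\pi_h(x,a)=\mathbb P^\pi[x_h=x,a_h=a]$ in $M^\star$, and $\pi^\star$ is an optimal deterministic policy of $M^\star$.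 **Model-based MLE.** Given a dataset $\mathcal D=\{\mathcal D_h\}_h$, choose (ties broken measurably) $\widehat M_h\in\arg\max_{M_h\in\mathcal M_h}\sum_{(x,a,r,x')\in\mathcal D_h}\log M_h(r,x'\mid x,a)$ for every $h$ and output $\widehat\pi=\pi^\star_{\widehat M}$. **Data.** $\mathcal D$ consists of $n$ rounds. In round $i$ a data distribution $\mu^{(i)}=(\mu^{(i)}_h)_h$ on $\mathcal X\times\mathcal A$ is chosen as a function of the previous rounds, and for every $h$ one sample $(x_h,a_h)\sim\mu^{(i)}_h$, $(r_h,x_{h+1})\sim M^\star_h(x_h,a_h)$ is drawn. Let $\mu^{(1:n)}_h=\frac1n\sum_i\mu_h^{(i)}$. For a distribution $\mu$ on $\mathcal X\times\mathcal A$ let $\mathsf{CC}_h(\pi,\mu,\gamma)=\sum_{x,a}d^\pi_h(x,a)\min\{d^\pi_h(x,a)/\mu(x,a),\gamma\}$, with $c/0=\infty$ for $c>0$ and $0/0=1$. An offline algorithm with output $\widehat\pi$ is *CC-bounded for all $\gamma>0$ simultaneously* with scaling functions $\mathfrak a_\gamma,\mathfrak b_\gamma$ if, for every $n\ge1$ and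 every such way of collecting data, with probability at least $1-\delta$, for all $\gamma>0$, $$J(\pi^\star)-J(\widehat\pi)\le\sum_{h=1}^H\frac{\mathfrak a_\gamma}{n}\Big(\mathsf{CC}_h(\pi^\star,\mu^{(1:n)}_h,\gamma n)+\mathsf{CC}_h(\widehat\pi,\mu^{(1:n)}_h,\gamma n)\Big)+\mathfrak b_\gamma .$$ **H₂O.** Given an offline dataset $\mathcal D_{\rm off}$ of $T$ i.i.d. rounds with $(x_h,a_h)\sim\nu_h$, $(r_h,x_{h+1})\sim M^\star_h(x_h,a_h)$ for every $h$ (the samples of one round may depend on each other across layers), iteration $t=1,\dots,T$ calls the offline algorithm on the first $t-1$ offline rounds together with the $t-1$ trajectories collected so far, gets $\pi^{(t)}$, and collects a new trajectory with $\pi^{(t)}$. Its output is $\mathsf{Unif}(\pi^{(1)},\dots,\pi^{(T)})$, and $\mathbf{Risk}=\frac1T\sum_{t=1}^T\big(J(\pi^\star)-J(\pi^{(t)})\big)$. Let $C_{\mathsf{cov}}=\inf_{\mu_1,\dots,\mu_H\in\Delta(\mathcal X\times\mathcal A)}\sup_{\pi\in\Pi,h}\|d^\pi_h/\mu_h\|_\infty$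 (finite, since $\Pi$ is). **Theorem.** There are universal constants $C>0$ and $k\in\mathbb N$ such that, for all data as above, if $M^\star\in\mathcal M$ and $\delta\in(0,1)$, then: 1. If the $H$ samples of each round are independent given the previous rounds, model-based MLE is CC-bounded for all $\gamma>0$ simultaneously with $\mathfrak a_\gamma=\frac6\gamma$ and $\mathfrak b_\gamma=8\gamma\log(|\mathcal M|H/\delta)$. 2. If the $H$ samples of each round may depend on each other arbitrarily (for instance, form a trajectory), the same holds with $\mathfrak a_\gamma=\frac6\gamma$ and the term $8\gamma\log(|\mathcal M|_\infty H/\delta)$ incurred once per layer, i.e. $\mathfrak b_\gamma=H\cdot 8\gamma\log(|\mathcal M|_\infty H/\delta)$. 3. For all $T\ge1$, if $\max_h\|d^{\pi^\star}_h/\nu_h\|_\infty\le C_\star<\infty$, then H₂O run with model-based MLE satisfies, with probability at least $1-\delta T$, $$\mathbf{Risk}\le C(1+\log T)^k\,H\sqrt{\frac{(C_\star+C_{\mathsf{cov}})\log(|\mathcal M|_\infty H/\delta)}{T}}$$ (and hence the same bound with $|\mathcal M|$ in place of $|\mathcal M|_\infty$). -/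

import Mathlib

open MeasureTheory ProbabilityTheory
open scoped ENNReal NNReal

noncomputable section

/-- A model for one layer: a conditional distribution over (reward, next state) given
(state, action), presented by its likelihood `dens x a (r, x')`, a probability density with
respect to `ρ ⊗ counting`. (For discrete rewards `ρ` is the counting measure of a countable set
of rewards and `dens` is the probability mass function.) -/
structure LayerModel (X A : Type*) [MeasurableSpace X] (ρ : Measure ℝ) where
  dens : X → A → ℝ × X → ℝ≥0
  measurable_dens : ∀ x a, Measurable (dens x a)
  lintegral_dens : ∀ x a, ∫⁻ y, (dens x a y : ℝ≥0∞) ∂(ρ.prod Measure.count) = 1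

/-- The conditional law of (reward, next state) given `(x, a)`. -/
def LayerModel.law {X A : Type*} [MeasurableSpace X] {ρ : Measure ℝ}
    (m : LayerModel X A ρ) (x : X) (a : A) : Measure (ℝ × X) :=
  (ρ.prod Measure.count).withDensity fun y => (m.dens x a y : ℝ≥0∞)

/-- A model with horizon `H`. Layers are numbered `0, …, H - 1`. -/
abbrev Model (X A : Type*) [MeasurableSpace X] (ρ : Measure ℝ) (H : ℕ) :=
  Fin H → LayerModel X A ρ

/-- Randomized (nonstationary, Markov) policies. -/
abbrev Policy (X A : Type*) (H : ℕ) := Fin H → X → PMF A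

/-- Deterministic policies. -/
abbrev DetPolicy (X A : Type*) (H : ℕ) := Fin H → X → A

/-- A deterministic policy as a policy. -/
def DetPolicy.toPolicy {X A : Type*} {H : ℕ} (π : DetPolicy X A H) : Policy X A H :=
  fun h x => PMF.pure (π h x)

/-- A sample `((x_h, a_h), (r_h, x_{h+1}))`. -/
abbrev Sample (X A : Type*) := (X × A) × (ℝ × X)

/-- One sample per layer; for instance a trajectory. -/
abbrev Round (X A : Type*) (H : ℕ) := Fin H → Sample X A

section MDP

variable {X A : Type*} [MeasurableSpace X] [MeasurableSpace A] {ρ : Measure ℝ}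

/-- The law of a trajectory of `k` steps started at state `x`:
`a ∼ π_0(x)`, `(r, x') ∼ M_0(x, a)`, and then on from `x'` with the remaining layers. -/
def trajFrom : {k : ℕ} → (Fin k → LayerModel X A ρ) → (Fin k → X → PMF A) → X →
    Measure (Fin k → Sample X A)
  | 0, _, _, _ => Measure.dirac Fin.elim0
  | _ + 1, M, π, x =>
      (π 0 x).toMeasure.bind fun a =>
        ((M 0).law x a).bind fun y =>
          (trajFrom (fun i => M i.succ) (fun i => π i.succ) y.2).map
            (Matrix.vecCons ((x, a), y))

variable {H : ℕ}

/-- `ℙ^π`: the law of the trajectory of `π` in the model `M` with initial distribution `d₁`. -/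
def trajLaw (M : Model X A ρ H) (d₁ : PMF X) (π : Policy X A H) : Measure (Round X A H) :=
  d₁.toMeasure.bind (trajFrom M π)

/-- The part of a layer-indexed sequence from layer `h` on. -/
def fromLayer {α : Type*} (f : Fin H → α) (h : Fin H) : Fin (H - h) → α :=
  fun i => f ⟨h + i, by omega⟩

/-- Total reward of a (partial) trajectory. -/
def totalReward {k : ℕ} (τ : Fin k → Sample X A) : ℝ := ∑ i, (τ i).2.1

/-- `J(π)`: expected total reward of `π` in the model `M`. -/
def expReward (M : Model X A ρ H) (d₁ : PMF X) (π : Policy X A H) : ℝ :=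
  ∫ τ, totalReward τ ∂(trajLaw M d₁ π)

/-- `V^π_h(x)`: expected reward collected by `π` in layers `h, h + 1, …` given `x_h = x`. -/
def valueFn (M : Model X A ρ H) (π : Policy X A H) (h : Fin H) (x : X) : ℝ :=
  ∫ τ, totalReward τ ∂(trajFrom (fromLayer M h) (fromLayer π h) x)

/-- `π` is an optimal deterministic policy for `M`: it maximizes the value at all layers and
states, among all policies. -/
def IsOptimalFor (M : Model X A ρ H) (π : DetPolicy X A H) : Prop :=
  ∀ (π' : Policy X A H) (h : Fin H) (x : X), valueFn M π' h x ≤ valueFn M π.toPolicy h x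

/-- Rewards lie in `[0,1]`, and so do the total rewards of all trajectories, almost surely
(whatever the policy and the layer and state at which the trajectory starts). -/
def NormalizedRewards (M : Model X A ρ H) : Prop :=
  (∀ h x a, ∀ᵐ y ∂((M h).law x a), y.1 ∈ Set.Icc (0 : ℝ) 1) ∧
  ∀ (π : Policy X A H) (h : Fin H) (x : X),
    ∀ᵐ τ ∂(trajFrom (fromLayer M h) (fromLayer π h) x), totalReward τ ∈ Set.Icc (0 : ℝ) 1

/-- The occupancy measure `d^π_h(x, a) = ℙ^π[x_h = x, a_h = a]`. -/
def occupancy (M : Model X A ρ H) (d₁ : PMF X) (π : Policy X A H) (h : Fin H) (z : X × A) :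
    ℝ≥0∞ :=
  trajLaw M d₁ π {τ | (τ h).1 = z}

/-- Density ratio `p / q` with the conventions `p / 0 = ∞` for `p > 0` and `0 / 0 = 1`. -/
def densRatio (p q : ℝ≥0∞) : ℝ≥0∞ :=
  open Classical in if p = 0 ∧ q = 0 then 1 else p / q

/-- Clipped concentrability coefficient at scale `γ ≥ 0`:
`‖min(d^π_h / μ, γ)‖_{1, d^π_h} = ∑ d^π_h(x, a) min(d^π_h(x, a) / μ(x, a), γ)`,
a number in `[0, γ]`. -/
def clippedConc (M : Model X A ρ H) (d₁ : PMF X) (π : Policy X A H) (h : Fin H)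
    (μ : X × A → ℝ≥0∞) (γ : ℝ) : ℝ :=
  (∑' z, occupancy M d₁ π h z *
    min (densRatio (occupancy M d₁ π h z) (μ z)) (ENNReal.ofReal γ)).toReal

/-- The coverability coefficient
`inf_{μ_1, …, μ_H ∈ Δ(X × A)} sup_{π ∈ Π, h} ‖d^π_h / μ_h‖_∞`. -/
def coverability (M : Model X A ρ H) (d₁ : PMF X) (Pi : Set (Policy X A H)) : ℝ≥0∞ :=
  ⨅ μ : Fin H → PMF (X × A), ⨆ π ∈ Pi, ⨆ h : Fin H, ⨆ z : X × A,
    densRatio (occupancy M d₁ π h z) (μ h z)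

/-- `C`-single-policy concentrability of the data distribution `ν`: `max_h ‖d^π_h / ν_h‖_∞ ≤ C`. -/
def SinglePolicyConc (M : Model X A ρ H) (d₁ : PMF X) (π : Policy X A H)
    (ν : Fin H → PMF (X × A)) (C : ℝ≥0∞) : Prop :=
  ∀ h z, densRatio (occupancy M d₁ π h z) (ν h z) ≤ C

/-! ### Datasets -/

/-- The law of one sample at a layer: `(x, a) ∼ μ` and `(r, x') ∼ m(x, a)`. -/
def sampleLaw (μ : PMF (X × A)) (m : LayerModel X A ρ) : Measure (Sample X A) :=
  μ.toMeasure.bind fun z => (m.law z.1 z.2).map (Prod.mk z)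

/-- The law of `(e_0, …, e_{n-1})` when `e_i ∼ κ_i(e_0, …, e_{i-1})`. -/
def iterLaw {E : Type*} [MeasurableSpace E] (κ : (i : ℕ) → (Fin i → E) → Measure E) :
    (n : ℕ) → Measure (Fin n → E)
  | 0 => Measure.dirac Fin.elim0
  | n + 1 => (iterLaw κ n).bind fun D =>
      (κ n D).map fun e => (Fin.snoc (α := fun _ => E) D e : Fin (n + 1) → E)

/-- First `i` elements of a sequence. -/
def firstElems {E : Type*} {n : ℕ} (D : Fin n → E) (i : ℕ) (hi : i ≤ n) : Fin i → E :=
  fun j => D (Fin.castLE hi j)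

/-- An adaptive way of collecting data in the MDP `Mstar`: in round `i` a data distribution
`dist i D = (μ_h)_h` is chosen as a function of the data `D` of the previous rounds, and one
sample is collected for each layer `h`, with `(x_h, a_h) ∼ μ_h` and `(r_h, x_{h+1}) ∼ Mstar_h`.
`kernel i D` is the joint law of these `H` samples. Their dependence across the layers is left
open (they may form a trajectory). -/
structure DataCollection (Mstar : Model X A ρ H) where
  kernel : (i : ℕ) → Kernel (Fin i → Round X A H) (Round X A H)
  markov : ∀ i, IsMarkovKernel (kernel i)
  dist : (i : ℕ) → (Fin i → Round X A H) → Fin H → PMF (X × A)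
  marginal : ∀ i D h, (kernel i D).map (fun s => s h) = sampleLaw (dist i D h) (Mstar h)

/-- The `H` samples of one round are independent of each other, given the previous rounds. -/
def DataCollection.LayerIndependent {Mstar : Model X A ρ H} (S : DataCollection Mstar) : Prop :=
  ∀ i D, S.kernel i D = Measure.pi fun h => sampleLaw (S.dist i D h) (Mstar h)

/-- The law of the dataset of `n` rounds. -/
def DataCollection.datasetLaw {Mstar : Model X A ρ H} (S : DataCollection Mstar) (n : ℕ) :
    Measure (Fin n → Round X A H) :=
  iterLaw (fun i D => S.kernel i D) n

/-- The mixture `μ^{1:n}_h = (1/n) ∑_i μ^i_h` of the data distributions used for `D`. -/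
def DataCollection.mixture {Mstar : Model X A ρ H} (S : DataCollection Mstar) {n : ℕ}
    (D : Fin n → Round X A H) (h : Fin H) (z : X × A) : ℝ≥0∞ :=
  (∑ i : Fin n, S.dist i (firstElems D i i.isLt.le) h z) / n

/-- An offline RL algorithm maps a dataset to a policy. -/
abbrev OfflineAlg (X A : Type*) (H : ℕ) := (n : ℕ) → (Fin n → Round X A H) → Policy X A H

/-- The offline algorithm `alg` is CC-bounded for all scales `γ > 0` simultaneously, with scaling
functions `a`, `b` and failure probability `δ`, on data collected as described by `adm`. -/
def CCBounded (alg : OfflineAlg X A H) (Mstar : Model X A ρ H) (d₁ : PMF X)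
    (πstar : DetPolicy X A H) (adm : DataCollection Mstar → Prop) (δ : ℝ) (a b : ℝ → ℝ) : Prop :=
  ∀ S : DataCollection Mstar, adm S → ∀ n : ℕ, 0 < n →
    S.datasetLaw n {D | ¬ ∀ γ : ℝ, 0 < γ →
      expReward Mstar d₁ πstar.toPolicy - expReward Mstar d₁ (alg n D) ≤
        (∑ h : Fin H, a γ / n *
          (clippedConc Mstar d₁ πstar.toPolicy h (S.mixture D h) (γ * n) +
            clippedConc Mstar d₁ (alg n D) h (S.mixture D h) (γ * n))) + b γ}
      ≤ ENNReal.ofReal δ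

/-! ### Model-based maximum likelihood estimation -/

/-- Log-likelihood of the layer model `m` on the layer-`h` data, with `log 0 = -∞`. -/
def logLik {n : ℕ} (D : Fin n → Round X A H) (h : Fin H) (m : LayerModel X A ρ) : EReal :=
  ∑ i : Fin n, ENNReal.log (m.dens (D i h).1.1 (D i h).1.2 (D i h).2 : ℝ≥0∞)

/-- The models of the class `{𝓜_h}_h`: one may combine any choices of layers. -/
def modelSet (𝓜 : Fin H → Finset (LayerModel X A ρ)) : Set (Model X A ρ H) :=
  {M | ∀ h, M h ∈ 𝓜 h}

/-- `Mhat` maximizes the likelihood in every layer. -/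
def IsMLE (𝓜 : Fin H → Finset (LayerModel X A ρ)) {n : ℕ} (D : Fin n → Round X A H)
    (Mhat : Model X A ρ H) : Prop :=
  ∀ h, Mhat h ∈ 𝓜 h ∧ ∀ m ∈ 𝓜 h, logLik D h m ≤ logLik D h (Mhat h)

/-- `est` computes a maximum likelihood estimator from each dataset, ties being broken in an
arbitrary measurable way. -/
def IsMLERule (𝓜 : Fin H → Finset (LayerModel X A ρ))
    (est : (n : ℕ) → (Fin n → Round X A H) → Model X A ρ H) : Prop :=
  (∀ n D, IsMLE 𝓜 D (est n D)) ∧ ∀ n M, MeasurableSet {D | est n D = M}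

/-- Model-based MLE: estimate the model and return its optimal policy. -/
def mleAlg (est : (n : ℕ) → (Fin n → Round X A H) → Model X A ρ H)
    (optPol : Model X A ρ H → DetPolicy X A H) : OfflineAlg X A H :=
  fun n D => (optPol (est n D)).toPolicy

/-- The policy class induced by the model class. -/
def inducedPolicies (𝓜 : Fin H → Finset (LayerModel X A ρ))
    (optPol : Model X A ρ H → DetPolicy X A H) : Set (Policy X A H) :=
  (fun M => (optPol M).toPolicy) '' modelSet 𝓜

/-- `∏_h |𝓜_h|`, the number of models in the class. -/
def numModels (𝓜 : Fin H → Finset (LayerModel X A ρ)) : ℕ := ∏ h, (𝓜 h).card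

/-- `max_h |𝓜_h|`. -/
def maxLayerModels (𝓜 : Fin H → Finset (LayerModel X A ρ)) : ℕ :=
  Finset.univ.sup fun h => (𝓜 h).card

/-! ### The hybrid-to-offline reduction H₂O -/

/-- The policy that H₂O executes after `t` iterations, given the offline data `Doff` and the online
data `Don` gathered so far: the output of `alg` on the first `t` offline samples together with the
`t` online ones. -/
def h2oPolicy (alg : OfflineAlg X A H) {T : ℕ} (Doff : Fin T → Round X A H) {t : ℕ} (ht : t ≤ T)
    (Don : Fin t → Round X A H) : Policy X A H :=
  alg (t + t) (Fin.append (firstElems Doff t ht) Don)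

/-- The law of all the data, offline and online, of a run of `T` iterations of H₂O. The offline
data are `T` independent draws from `q`; then in each iteration a trajectory is drawn with the
current policy. (The `else` branch is never used: only `t < T` occurs.) -/
def h2oLaw (alg : OfflineAlg X A H) (Mstar : Model X A ρ H) (d₁ : PMF X)
    (q : Measure (Round X A H)) (T : ℕ) :
    Measure ((Fin T → Round X A H) × (Fin T → Round X A H)) :=
  (Measure.pi fun _ : Fin T => q).bind fun Doff =>
    (iterLaw (fun t Don =>
      if ht : t ≤ T then trajLaw Mstar d₁ (h2oPolicy alg Doff ht Don) else 0) T).map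
      (Prod.mk Doff)

/-- The risk `𝔼_{π ∼ Unif(π_1, …, π_T)} [J(π⋆) - J(π)]` of the output of H₂O. -/
def h2oRisk (alg : OfflineAlg X A H) (Mstar : Model X A ρ H) (d₁ : PMF X)
    (πstar : DetPolicy X A H) {T : ℕ} (D : (Fin T → Round X A H) × (Fin T → Round X A H)) : ℝ :=
  (∑ t : Fin T, (expReward Mstar d₁ πstar.toPolicy -
    expReward Mstar d₁ (h2oPolicy alg D.1 t.isLt.le (firstElems D.2 t t.isLt.le)))) / T

end MDP

end

set_option linter.unusedSectionVars false

/-! ### Products under product measures and under sequentially generated data -/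

theorem lintegral_pi_prod_eq_prod {E : Type*} [MeasurableSpace E] :
    ∀ {n : ℕ} (μ : Fin n → Measure E) [∀ i, IsProbabilityMeasure (μ i)]
      (f : Fin n → E → ℝ≥0∞), (∀ i, Measurable (f i)) →
      ∫⁻ x, ∏ i, f i (x i) ∂(Measure.pi μ) = ∏ i, ∫⁻ x, f i x ∂(μ i)
  | 0, μ, _, f, _ => by simp
  | n + 1, μ, _, f, hf => by
    have ih := lintegral_pi_prod_eq_prod (fun i => μ (Fin.succ i)) (fun i => f (Fin.succ i))
      (fun i => hf _)
    have hmp := (measurePreserving_piFinSuccAbove μ 0).symm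
    rw [← hmp.lintegral_comp_emb (MeasurableEquiv.measurableEmbedding _), Fin.prod_univ_succ]
    have hm : Measurable fun x : Fin n → E => ∏ i : Fin n, f (Fin.succ i) (x i) :=
      Finset.measurable_prod _ fun i _ => (hf _).comp (measurable_pi_apply i)
    have key := lintegral_prod_mul (μ := μ 0) (ν := Measure.pi fun i => μ (Fin.succ i))
      (hf 0).aemeasurable hm.aemeasurable
    rw [ih] at key
    rw [← key]
    refine lintegral_congr fun x => ?_
    rw [Fin.prod_univ_succ]
    rfl

theorem firstElems_snoc {E : Type*} {n : ℕ} (D : Fin n → E) (e : E) (i : ℕ) (hi : i ≤ n) :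
    firstElems (Fin.snoc (α := fun _ => E) D e) i (hi.trans n.le_succ) = firstElems D i hi := by
  funext j
  have : (Fin.castLE (hi.trans n.le_succ) j : Fin (n + 1)) = Fin.castSucc (Fin.castLE hi j) := rfl
  simp only [firstElems, this, Fin.snoc_castSucc]

/-- A product of nonnegative factors with conditional means at most one has mean at most one. -/
theorem lintegral_iterLaw_prod_le_one {E : Type*} [MeasurableSpace E]
    (κ : (i : ℕ) → (Fin i → E) → Measure E) (g : (i : ℕ) → (Fin i → E) → E → ℝ≥0∞) (n : ℕ)
    (hg : ∀ i < n, ∀ D, Measurable (g i D))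
    (h1 : ∀ i < n, ∀ D, ∫⁻ e, g i D e ∂(κ i D) ≤ 1) :
    ∫⁻ D, ∏ i : Fin n, g i (firstElems D i i.isLt.le) (D i) ∂(iterLaw κ n) ≤ 1 := by
  induction n with
  | zero =>
    have : Measurable fun _ : Fin 0 → E => (1 : ℝ≥0∞) := measurable_const
    simp [iterLaw, lintegral_dirac' _ this]
  | succ n ih =>
    refine le_trans (Measure.lintegral_bind_le _ _ _) (le_trans (lintegral_mono fun D => ?_)
      (ih (fun i hi => hg i (hi.trans n.lt_succ_self)) fun i hi => h1 i (hi.trans n.lt_succ_self)))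
    refine le_trans (lintegral_map_le _ _) ?_
    have : ∀ e : E, ∏ i : Fin (n + 1), g i (firstElems (Fin.snoc (α := fun _ => E) D e) i i.isLt.le)
        (Fin.snoc (α := fun _ => E) D e i) =
        (∏ i : Fin n, g i (firstElems D i i.isLt.le) (D i)) * g n D e := by
      intro e
      rw [Fin.prod_univ_castSucc]
      congr 1
      · refine Finset.prod_congr rfl fun i _ => ?_
        rw [Fin.snoc_castSucc]
        congr 1
        exact firstElems_snoc D e i i.isLt.le
      · rw [Fin.snoc_last]
        congr 1
        exact firstElems_snoc D e n le_rfl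
    simp_rw [this]
    rw [lintegral_const_mul _ (hg n n.lt_succ_self D)]
    exact mul_le_of_le_one_right' (h1 n n.lt_succ_self D)

/-- What holds almost surely for every conditional law holds almost surely for all the data. -/
theorem lintegral_iterLaw_sum_eq_zero {E : Type*} [MeasurableSpace E]
    (κ : (i : ℕ) → (Fin i → E) → Measure E) (g : E → ℝ≥0∞) (n : ℕ) (hg : Measurable g)
    (hprob : ∀ i < n, ∀ D, κ i D Set.univ ≤ 1)
    (h0 : ∀ i < n, ∀ D, ∫⁻ e, g e ∂(κ i D) = 0) :
    ∫⁻ D, ∑ i : Fin n, g (D i) ∂(iterLaw κ n) = 0 := by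
  induction n with
  | zero => simp
  | succ n ih =>
    have ih' := ih (fun i hi => hprob i (hi.trans n.lt_succ_self))
      fun i hi => h0 i (hi.trans n.lt_succ_self)
    rw [← nonpos_iff_eq_zero]
    refine le_trans (Measure.lintegral_bind_le _ _ _) (le_trans (lintegral_mono fun D => ?_) ih'.le)
    refine le_trans (lintegral_map_le _ _) ?_
    simp only [Fin.sum_univ_castSucc, Fin.snoc_castSucc, Fin.snoc_last]
    rw [lintegral_add_right _ hg, h0 n n.lt_succ_self D, lintegral_const, add_zero]
    exact mul_le_of_le_one_right' (hprob n n.lt_succ_self D)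

/-! ### Integrals with respect to the conditional laws and the laws of trajectories -/

section MDP

variable {X A : Type*} [MeasurableSpace X] [MeasurableSpace A] {ρ : Measure ℝ}

theorem PMF.lintegral_eq_tsum_mul {α : Type*} [Countable α] [MeasurableSpace α]
    [DiscreteMeasurableSpace α] (p : PMF α) (f : α → ℝ≥0∞) :
    ∫⁻ a, f a ∂p.toMeasure = ∑' a, p a * f a := by
  rw [lintegral_countable']
  simp_rw [p.toMeasure_apply_singleton _ (measurableSet_singleton _), mul_comm]

instance LayerModel.isProbabilityMeasure_law (m : LayerModel X A ρ) (x : X) (a : A) :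
    IsProbabilityMeasure (m.law x a) := by
  constructor
  rw [LayerModel.law, withDensity_apply _ MeasurableSet.univ, Measure.restrict_univ]
  exact m.lintegral_dens x a

theorem LayerModel.lintegral_law (m : LayerModel X A ρ) (x : X) (a : A) {f : ℝ × X → ℝ≥0∞}
    (hf : Measurable f) :
    ∫⁻ y, f y ∂(m.law x a) = ∫⁻ y, m.dens x a y * f y ∂(ρ.prod Measure.count) := by
  rw [LayerModel.law, lintegral_withDensity_eq_lintegral_mul _
    (m.measurable_dens x a).coe_nnreal_ennreal hf]
  rfl

theorem measurable_vecCons {α : Type*} [MeasurableSpace α] {k : ℕ} :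
    Measurable fun p : α × (Fin k → α) => (Matrix.vecCons p.1 p.2 : Fin (k + 1) → α) := by
  refine measurable_pi_iff.2 fun i => ?_
  refine Fin.cases ?_ (fun j => ?_) i
  · simpa using measurable_fst
  · simp only [Matrix.cons_val_succ]
    exact (measurable_pi_apply j).comp measurable_snd

variable [Countable X] [DiscreteMeasurableSpace X] [Countable A] [DiscreteMeasurableSpace A]

theorem measurable_map_vecCons {k : ℕ} (κ : X → Measure (Fin k → Sample X A))
    [∀ x, IsProbabilityMeasure (κ x)] (z : X × A) :
    Measurable fun y : ℝ × X => (κ y.2).map (Matrix.vecCons (z, y)) := by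
  refine Measure.measurable_of_measurable_coe _ fun s hs => ?_
  refine measurable_from_prod_countable_left fun x => ?_
  have h1 : ∀ y : ℝ × X, Measurable (Matrix.vecCons (z, y) :
      (Fin k → Sample X A) → (Fin (k + 1) → Sample X A)) := fun y =>
    measurable_vecCons.comp (measurable_const.prodMk measurable_id)
  simp_rw [fun r => Measure.map_apply (μ := κ x) (h1 (r, x)) hs]
  have h2 : Measurable fun p : ℝ × (Fin k → Sample X A) =>
      (Matrix.vecCons (z, (p.1, x)) p.2 : Fin (k + 1) → Sample X A) :=
    measurable_vecCons.comp ((measurable_const.prodMk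
      (measurable_fst.prodMk measurable_const)).prodMk measurable_snd)
  exact measurable_measure_prodMk_left (h2 hs)

instance isProbabilityMeasure_trajFrom {k : ℕ} (M : Fin k → LayerModel X A ρ)
    (π : Fin k → X → PMF A) (x : X) : IsProbabilityMeasure (trajFrom M π x) := by
  induction k generalizing x with
  | zero => exact Measure.dirac.isProbabilityMeasure
  | succ k ih =>
    have := ih (fun i => M i.succ) (fun i => π i.succ)
    constructor
    rw [trajFrom, Measure.bind_apply MeasurableSet.univ (Measurable.of_discrete).aemeasurable]
    have h : ∀ a, (((M 0).law x a).bind fun y =>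
          (trajFrom (fun i => M i.succ) (fun i => π i.succ) y.2).map
            (Matrix.vecCons ((x, a), y))) Set.univ = 1 := by
      intro a
      rw [Measure.bind_apply MeasurableSet.univ (measurable_map_vecCons _ _).aemeasurable]
      have h1 : ∀ y : ℝ × X, Measurable (Matrix.vecCons ((x, a), y) :
          (Fin k → Sample X A) → (Fin (k + 1) → Sample X A)) := fun y =>
        measurable_vecCons.comp (measurable_const.prodMk measurable_id)
      simp [Measure.map_apply (h1 _) MeasurableSet.univ]
    simp [h]

theorem lintegral_trajFrom_succ {k : ℕ} (M : Fin (k + 1) → LayerModel X A ρ)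
    (π : Fin (k + 1) → X → PMF A) (x : X) {f : (Fin (k + 1) → Sample X A) → ℝ≥0∞}
    (hf : Measurable f) :
    ∫⁻ τ, f τ ∂(trajFrom M π x) =
      ∫⁻ a, ∫⁻ y, ∫⁻ τ, f (Matrix.vecCons ((x, a), y) τ)
        ∂(trajFrom (fun i => M i.succ) (fun i => π i.succ) y.2) ∂((M 0).law x a)
        ∂((π 0 x).toMeasure) := by
  rw [trajFrom, Measure.lintegral_bind (Measurable.of_discrete).aemeasurable hf.aemeasurable]
  refine lintegral_congr fun a => ?_
  rw [Measure.lintegral_bind (measurable_map_vecCons _ _).aemeasurable hf.aemeasurable]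
  refine lintegral_congr fun y => ?_
  have h1 : Measurable (Matrix.vecCons ((x, a), y) :
      (Fin k → Sample X A) → (Fin (k + 1) → Sample X A)) :=
    measurable_vecCons.comp (measurable_const.prodMk measurable_id)
  exact lintegral_map hf h1

theorem lintegral_trajFrom_eval {k : ℕ} (M : Fin k → LayerModel X A ρ)
    (π : Fin k → X → PMF A) (x : X) (i : Fin k) {g : Sample X A → ℝ≥0∞} (hg : Measurable g) :
    ∫⁻ τ, g (τ i) ∂(trajFrom M π x) =
      ∫⁻ τ, ∫⁻ y, g ((τ i).1, y) ∂((M i).law (τ i).1.1 (τ i).1.2) ∂(trajFrom M π x) := by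
  have hG : ∀ m : LayerModel X A ρ,
      Measurable fun s : Sample X A => ∫⁻ y, g (s.1, y) ∂(m.law s.1.1 s.1.2) := by
    intro m
    exact (Measurable.of_discrete (f := fun z : X × A => ∫⁻ y, g (z, y) ∂(m.law z.1 z.2))).comp
      measurable_fst
  induction k generalizing x with
  | zero => exact i.elim0
  | succ k ih =>
    have e1 := lintegral_trajFrom_succ M π x (hg.comp (measurable_pi_apply i))
    have e2 := lintegral_trajFrom_succ M π x ((hG (M i)).comp (measurable_pi_apply i))
    simp only [Function.comp_apply] at e1 e2
    rw [e1, e2]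
    refine lintegral_congr fun a => ?_
    refine Fin.cases ?_ (fun j => ?_) i
    · simp
    · simp only [Matrix.cons_val_succ]
      exact lintegral_congr fun y => ih (fun i => M i.succ) (fun i => π i.succ) y.2 j

variable {H : ℕ}

theorem lintegral_trajLaw (M : Model X A ρ H) (d₁ : PMF X) (π : Policy X A H)
    {f : Round X A H → ℝ≥0∞} (hf : Measurable f) :
    ∫⁻ τ, f τ ∂(trajLaw M d₁ π) = ∫⁻ x, ∫⁻ τ, f τ ∂(trajFrom M π x) ∂d₁.toMeasure :=
  Measure.lintegral_bind (Measurable.of_discrete).aemeasurable hf.aemeasurable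

instance isProbabilityMeasure_trajLaw (M : Model X A ρ H) (d₁ : PMF X) (π : Policy X A H) :
    IsProbabilityMeasure (trajLaw M d₁ π) := by
  constructor
  rw [trajLaw, Measure.bind_apply MeasurableSet.univ (Measurable.of_discrete).aemeasurable]
  simp

theorem lintegral_trajLaw_fst (M : Model X A ρ H) (d₁ : PMF X) (π : Policy X A H) (h : Fin H)
    (f : X × A → ℝ≥0∞) :
    ∫⁻ τ, f (τ h).1 ∂(trajLaw M d₁ π) = ∑' z, occupancy M d₁ π h z * f z := by
  have hm : Measurable fun τ : Round X A H => (τ h).1 :=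
    measurable_fst.comp (measurable_pi_apply h)
  rw [← lintegral_map (f := f) Measurable.of_discrete hm, lintegral_countable']
  refine tsum_congr fun z => ?_
  rw [Measure.map_apply hm (measurableSet_singleton z), mul_comm]
  rfl

theorem tsum_occupancy (M : Model X A ρ H) (d₁ : PMF X) (π : Policy X A H) (h : Fin H) :
    ∑' z, occupancy M d₁ π h z = 1 := by
  have := lintegral_trajLaw_fst M d₁ π h 1
  simpa using this.symm

theorem lintegral_trajLaw_eval (M : Model X A ρ H) (d₁ : PMF X) (π : Policy X A H) (h : Fin H)
    {g : Sample X A → ℝ≥0∞} (hg : Measurable g) :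
    ∫⁻ τ, g (τ h) ∂(trajLaw M d₁ π) =
      ∑' z, occupancy M d₁ π h z * ∫⁻ y, g (z, y) ∂((M h).law z.1 z.2) := by
  have e := lintegral_trajLaw M d₁ π (hg.comp (measurable_pi_apply h))
  simp only [Function.comp_apply] at e
  rw [← lintegral_trajLaw_fst M d₁ π h fun z => ∫⁻ y, g (z, y) ∂((M h).law z.1 z.2), e,
    lintegral_trajLaw]
  · exact lintegral_congr fun x => lintegral_trajFrom_eval M π x h hg
  · exact (Measurable.of_discrete (f := fun z : X × A =>
      ∫⁻ y, g (z, y) ∂((M h).law z.1 z.2))).comp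
        (measurable_fst.comp (measurable_pi_apply h))

theorem lintegral_sampleLaw (μ : PMF (X × A)) (m : LayerModel X A ρ) {g : Sample X A → ℝ≥0∞}
    (hg : Measurable g) :
    ∫⁻ s, g s ∂(sampleLaw μ m) = ∑' z, μ z * ∫⁻ y, g (z, y) ∂(m.law z.1 z.2) := by
  rw [sampleLaw, Measure.lintegral_bind (Measurable.of_discrete).aemeasurable hg.aemeasurable,
    PMF.lintegral_eq_tsum_mul]
  refine tsum_congr fun z => ?_
  rw [lintegral_map hg measurable_prodMk_left]

instance isProbabilityMeasure_sampleLaw (μ : PMF (X × A)) (m : LayerModel X A ρ) :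
    IsProbabilityMeasure (sampleLaw μ m) := by
  constructor
  have := lintegral_sampleLaw μ m (g := 1) measurable_const
  simpa using this

end MDP

noncomputable section

section MDP

variable {X A : Type*} [MeasurableSpace X] [MeasurableSpace A] {ρ : Measure ℝ}

/-! ### Distances between layer models -/

/-- Squared Hellinger distance `∫ (√p - √q)²` between the conditional laws at `z`. -/
def hellSq (m m' : LayerModel X A ρ) (z : X × A) : ℝ≥0∞ :=
  ∫⁻ y, ((nndist (NNReal.sqrt (m.dens z.1 z.2 y)) (NNReal.sqrt (m'.dens z.1 z.2 y)) ^ 2 : ℝ≥0) :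
    ℝ≥0∞) ∂(ρ.prod Measure.count)

/-- Bhattacharyya coefficient `∫ √(p q)` of the conditional laws at `z`. -/
def bhatt (m m' : LayerModel X A ρ) (z : X × A) : ℝ≥0∞ :=
  ∫⁻ y, ((NNReal.sqrt (m.dens z.1 z.2 y) * NNReal.sqrt (m'.dens z.1 z.2 y) : ℝ≥0) : ℝ≥0∞)
    ∂(ρ.prod Measure.count)

/-- `L¹` distance `∫ |p - q|` of the conditional laws at `z`. -/
def l1Dist (m m' : LayerModel X A ρ) (z : X × A) : ℝ≥0∞ :=
  ∫⁻ y, (nndist (m.dens z.1 z.2 y) (m'.dens z.1 z.2 y) : ℝ≥0∞) ∂(ρ.prod Measure.count)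

theorem l1Dist_comm (m m' : LayerModel X A ρ) (z : X × A) : l1Dist m m' z = l1Dist m' m z := by
  simp only [l1Dist, nndist_comm]

theorem hellSq_add_two_mul_bhatt (m m' : LayerModel X A ρ) (z : X × A) :
    hellSq m m' z + 2 * bhatt m m' z = 2 := by
  have hp := m.measurable_dens z.1 z.2
  have hq := m'.measurable_dens z.1 z.2
  have hm : Measurable fun y => ((NNReal.sqrt (m.dens z.1 z.2 y) *
      NNReal.sqrt (m'.dens z.1 z.2 y) : ℝ≥0) : ℝ≥0∞) :=
    ((NNReal.continuous_sqrt.measurable.comp hp).mul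
      (NNReal.continuous_sqrt.measurable.comp hq)).coe_nnreal_ennreal
  have e : ∀ p q : ℝ≥0, ((nndist (NNReal.sqrt p) (NNReal.sqrt q) ^ 2 : ℝ≥0) : ℝ≥0∞) +
      2 * ((NNReal.sqrt p * NNReal.sqrt q : ℝ≥0) : ℝ≥0∞) = (p : ℝ≥0∞) + (q : ℝ≥0∞) := by
    intro p q
    have : nndist (NNReal.sqrt p) (NNReal.sqrt q) ^ 2 + 2 * (NNReal.sqrt p * NNReal.sqrt q)
        = p + q := by
      apply NNReal.coe_injective
      push_cast
      rw [NNReal.dist_eq, sq_abs]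
      have h1 := Real.sq_sqrt p.coe_nonneg
      have h2 := Real.sq_sqrt q.coe_nonneg
      simp only [Real.coe_sqrt]
      nlinarith
    exact_mod_cast this
  rw [hellSq, bhatt, ← lintegral_const_mul _ hm, ← lintegral_add_right _ (hm.const_mul _)]
  simp_rw [e]
  rw [lintegral_add_left hp.coe_nnreal_ennreal, m.lintegral_dens, m'.lintegral_dens]
  norm_num

theorem hellSq_le_two (m m' : LayerModel X A ρ) (z : X × A) : hellSq m m' z ≤ 2 :=
  (hellSq_add_two_mul_bhatt m m' z) ▸ le_self_add

theorem bhatt_add_half_hellSq (m m' : LayerModel X A ρ) (z : X × A) :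
    bhatt m m' z + hellSq m m' z / 2 = 1 := by
  have h := hellSq_add_two_mul_bhatt m m' z
  have h2 : (hellSq m m' z + 2 * bhatt m m' z) / 2 = 1 := by
    rw [h]; exact ENNReal.div_self (by norm_num) (by norm_num)
  rw [ENNReal.add_div, mul_comm, ENNReal.mul_div_cancel_right (by norm_num) (by norm_num)] at h2
  rw [add_comm]; exact h2

theorem l1Dist_le_two (m m' : LayerModel X A ρ) (z : X × A) : l1Dist m m' z ≤ 2 := by
  have hp := m.measurable_dens z.1 z.2
  calc l1Dist m m' z ≤ ∫⁻ y, ((m.dens z.1 z.2 y : ℝ≥0∞) + (m'.dens z.1 z.2 y : ℝ≥0∞))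
        ∂(ρ.prod Measure.count) := by
        refine lintegral_mono fun y => ?_
        have : nndist (m.dens z.1 z.2 y) (m'.dens z.1 z.2 y) ≤
            m.dens z.1 z.2 y + m'.dens z.1 z.2 y := by
          rw [← NNReal.coe_le_coe, coe_nndist, NNReal.dist_eq, NNReal.coe_add]
          have h1 := (m.dens z.1 z.2 y).coe_nonneg
          have h2 := (m'.dens z.1 z.2 y).coe_nonneg
          rw [abs_le]; constructor <;> linarith
        exact ENNReal.coe_le_coe.2 this
    _ = 2 := by
        rw [lintegral_add_left hp.coe_nnreal_ennreal, m.lintegral_dens, m'.lintegral_dens]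
        norm_num

theorem l1Dist_le_hellSq (m m' : LayerModel X A ρ) (z : X × A) {β : ℝ≥0} (hβ : 0 < β) :
    l1Dist m m' z ≤ hellSq m m' z / (2 * β) + 2 * β := by
  have hp := m.measurable_dens z.1 z.2
  have hq := m'.measurable_dens z.1 z.2
  have hm : Measurable fun y => ((nndist (NNReal.sqrt (m.dens z.1 z.2 y))
      (NNReal.sqrt (m'.dens z.1 z.2 y)) ^ 2 : ℝ≥0) : ℝ≥0∞) :=
    (((NNReal.continuous_sqrt.measurable.comp hp).nndist
      (NNReal.continuous_sqrt.measurable.comp hq)).pow_const 2).coe_nnreal_ennreal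
  have e : ∀ p q : ℝ≥0, (nndist p q : ℝ≥0∞) ≤ ((2 * β : ℝ≥0) : ℝ≥0∞)⁻¹ *
      ((nndist (NNReal.sqrt p) (NNReal.sqrt q) ^ 2 : ℝ≥0) : ℝ≥0∞) +
      β * ((p : ℝ≥0∞) + (q : ℝ≥0∞)) := by
    intro p q
    have : nndist p q ≤ (2 * β)⁻¹ * nndist (NNReal.sqrt p) (NNReal.sqrt q) ^ 2 + β * (p + q) := by
      rw [← NNReal.coe_le_coe]
      push_cast
      rw [NNReal.dist_eq, NNReal.dist_eq]
      simp only [Real.coe_sqrt]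
      have hβ' : (0 : ℝ) < β := hβ
      have h1 := Real.sq_sqrt p.coe_nonneg
      have h2 := Real.sq_sqrt q.coe_nonneg
      set a := √(p : ℝ)
      set b := √(q : ℝ)
      have ha : 0 ≤ a := Real.sqrt_nonneg _
      have hb : 0 ≤ b := Real.sqrt_nonneg _
      rw [← h1, ← h2, show a ^ 2 - b ^ 2 = (a - b) * (a + b) by ring, abs_mul,
        abs_of_nonneg (add_nonneg ha hb)]
      set d := |a - b|
      have h3 : d * (a + b) ≤ (2 * (β : ℝ))⁻¹ * d ^ 2 + β / 2 * (a + b) ^ 2 := by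
        have : (2 * (β : ℝ))⁻¹ * d ^ 2 + β / 2 * (a + b) ^ 2 - d * (a + b) =
          (2 * (β : ℝ))⁻¹ * (d - β * (a + b)) ^ 2 := by field_simp; ring
        have h4 : 0 ≤ (2 * (β : ℝ))⁻¹ * (d - β * (a + b)) ^ 2 := by positivity
        linarith
      have h5 : (β : ℝ) / 2 * (a + b) ^ 2 ≤ β * (a ^ 2 + b ^ 2) := by
        nlinarith [mul_nonneg hβ'.le (sq_nonneg (a - b))]
      linarith
    rw [← ENNReal.coe_inv (by positivity), ← ENNReal.coe_add, ← ENNReal.coe_mul,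
      ← ENNReal.coe_mul, ← ENNReal.coe_add]
    exact ENNReal.coe_le_coe.2 this
  calc l1Dist m m' z ≤ ∫⁻ y, (((2 * β : ℝ≥0) : ℝ≥0∞)⁻¹ *
      ((nndist (NNReal.sqrt (m.dens z.1 z.2 y)) (NNReal.sqrt (m'.dens z.1 z.2 y)) ^ 2 : ℝ≥0) :
        ℝ≥0∞) + β * ((m.dens z.1 z.2 y : ℝ≥0∞) + (m'.dens z.1 z.2 y : ℝ≥0∞)))
        ∂(ρ.prod Measure.count) := lintegral_mono fun y => e _ _
    _ = ((2 * β : ℝ≥0) : ℝ≥0∞)⁻¹ * hellSq m m' z + β * 2 := by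
        rw [lintegral_add_left (hm.const_mul _), lintegral_const_mul _ hm,
          lintegral_const_mul' _ _ ENNReal.coe_ne_top,
          lintegral_add_left hp.coe_nnreal_ennreal, m.lintegral_dens, m'.lintegral_dens,
          one_add_one_eq_two]
        rfl
    _ = _ := by
        rw [ENNReal.div_eq_inv_mul, mul_comm (β : ℝ≥0∞)]
        push_cast
        rfl

theorem lintegral_law_le_add (m m' : LayerModel X A ρ) (z : X × A) {f : ℝ × X → ℝ≥0∞}
    (hf : Measurable f) {c : ℝ≥0∞} (hc : ∀ y, f y ≤ c) :
    ∫⁻ y, f y ∂(m.law z.1 z.2) ≤ ∫⁻ y, f y ∂(m'.law z.1 z.2) + c * l1Dist m m' z := by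
  have hp := m.measurable_dens z.1 z.2
  have hq := m'.measurable_dens z.1 z.2
  have hqf : Measurable fun y => (m'.dens z.1 z.2 y : ℝ≥0∞) * f y := hq.coe_nnreal_ennreal.mul hf
  rw [m.lintegral_law _ _ hf, m'.lintegral_law _ _ hf, l1Dist,
    ← lintegral_const_mul _ (hp.nndist hq).coe_nnreal_ennreal, ← lintegral_add_left hqf]
  refine lintegral_mono fun y => ?_
  have h : m.dens z.1 z.2 y ≤ m'.dens z.1 z.2 y + nndist (m.dens z.1 z.2 y) (m'.dens z.1 z.2 y) := by
    rw [← NNReal.coe_le_coe, NNReal.coe_add, coe_nndist, NNReal.dist_eq]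
    linarith [le_abs_self ((m.dens z.1 z.2 y : ℝ) - m'.dens z.1 z.2 y)]
  have h' : (m.dens z.1 z.2 y : ℝ≥0∞) ≤ (m'.dens z.1 z.2 y : ℝ≥0∞) +
      (nndist (m.dens z.1 z.2 y) (m'.dens z.1 z.2 y) : ℝ≥0∞) := by
    rw [← ENNReal.coe_add]; exact ENNReal.coe_le_coe.2 h
  calc (m.dens z.1 z.2 y : ℝ≥0∞) * f y ≤ _ * f y := mul_le_mul_left h' _
    _ ≤ _ := by
      rw [add_mul]
      refine add_le_add le_rfl ?_
      rw [mul_comm]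
      exact mul_le_mul_left (hc y) _

/-! ### Values and the simulation lemma -/

/-- The reward of a transition, truncated to `[0, 1]`. -/
def truncReward (y : ℝ × X) : ℝ≥0∞ := min (ENNReal.ofReal y.1) 1

theorem measurable_truncReward : Measurable (truncReward : ℝ × X → ℝ≥0∞) :=
  (ENNReal.measurable_ofReal.comp measurable_fst).min measurable_const

/-- Expected total truncated reward from a state on. -/
def truncValue {k : ℕ} (M : Fin k → LayerModel X A ρ) (π : Fin k → X → PMF A) (x : X) : ℝ≥0∞ :=
  ∫⁻ τ, ∑ i, truncReward (τ i).2 ∂(trajFrom M π x)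

/-- Expected total `L¹` distance of two models along a trajectory in the second one. -/
def simError {k : ℕ} (M M' : Fin k → LayerModel X A ρ) (π : Fin k → X → PMF A) (x : X) : ℝ≥0∞ :=
  ∫⁻ τ, ∑ i, 2 * l1Dist (M i) (M' i) (τ i).1 ∂(trajFrom M' π x)

/-- All truncated values, from every layer on, are at most one. -/
def ValuesLeOne : {k : ℕ} → (Fin k → LayerModel X A ρ) → (Fin k → X → PMF A) → Prop
  | 0, _, _ => True
  | _ + 1, M, π => (∀ x, truncValue M π x ≤ 1) ∧
      ValuesLeOne (fun i => M i.succ) (fun i => π i.succ)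

theorem ValuesLeOne.truncValue_le_one {k : ℕ} {M : Fin k → LayerModel X A ρ}
    {π : Fin k → X → PMF A} (h : ValuesLeOne M π) (x : X) : truncValue M π x ≤ 1 := by
  cases k with
  | zero => simp [truncValue]
  | succ k => exact h.1 x

variable [Countable X] [DiscreteMeasurableSpace X] [Countable A] [DiscreteMeasurableSpace A]

theorem measurable_sum_truncReward {k : ℕ} :
    Measurable fun τ : Fin k → Sample X A => ∑ i, truncReward (τ i).2 :=
  Finset.measurable_sum _ fun i _ =>
    measurable_truncReward.comp (measurable_snd.comp (measurable_pi_apply i))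

theorem measurable_sum_l1Dist {k : ℕ} (M M' : Fin k → LayerModel X A ρ) :
    Measurable fun τ : Fin k → Sample X A => ∑ i, 2 * l1Dist (M i) (M' i) (τ i).1 :=
  Finset.measurable_sum _ fun i _ =>
    (Measurable.of_discrete (f := fun z => 2 * l1Dist (M i) (M' i) z)).comp
      (measurable_fst.comp (measurable_pi_apply i))

theorem truncValue_succ {k : ℕ} (M : Fin (k + 1) → LayerModel X A ρ)
    (π : Fin (k + 1) → X → PMF A) (x : X) :
    truncValue M π x = ∫⁻ a, ∫⁻ y, (truncReward y +
      truncValue (fun i => M i.succ) (fun i => π i.succ) y.2) ∂((M 0).law x a)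
        ∂((π 0 x).toMeasure) := by
  rw [truncValue, lintegral_trajFrom_succ _ _ _ measurable_sum_truncReward]
  refine lintegral_congr fun a => lintegral_congr fun y => ?_
  simp only [Fin.sum_univ_succ, Matrix.cons_val_zero, Matrix.cons_val_succ]
  rw [lintegral_add_left measurable_const, lintegral_const, measure_univ, mul_one]
  rfl

theorem simError_succ {k : ℕ} (M M' : Fin (k + 1) → LayerModel X A ρ)
    (π : Fin (k + 1) → X → PMF A) (x : X) :
    simError M M' π x = ∫⁻ a, (2 * l1Dist (M 0) (M' 0) (x, a) + ∫⁻ y,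
      simError (fun i => M i.succ) (fun i => M' i.succ) (fun i => π i.succ) y.2
        ∂((M' 0).law x a)) ∂((π 0 x).toMeasure) := by
  rw [simError, lintegral_trajFrom_succ _ _ _ (measurable_sum_l1Dist M M')]
  refine lintegral_congr fun a => ?_
  simp only [Fin.sum_univ_succ, Matrix.cons_val_zero, Matrix.cons_val_succ]
  have e : 2 * l1Dist (M 0) (M' 0) (x, a) =
      ∫⁻ _, 2 * l1Dist (M 0) (M' 0) (x, a) ∂((M' 0).law x a) := by simp
  conv_rhs => rw [e]
  rw [← lintegral_add_left measurable_const]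
  refine lintegral_congr fun y => ?_
  rw [lintegral_add_left measurable_const, lintegral_const, measure_univ, mul_one]
  rfl

theorem measurable_of_snd (f : X → ℝ≥0∞) : Measurable fun y : ℝ × X => f y.2 :=
  (Measurable.of_discrete (f := f)).comp measurable_snd

theorem truncReward_add_le_two {v : X → ℝ≥0∞} (hv : ∀ x, v x ≤ 1) (y : ℝ × X) :
    truncReward y + v y.2 ≤ 2 := by
  rw [← one_add_one_eq_two]
  exact add_le_add (min_le_right _ _) (hv _)

theorem truncValue_le_add_simError {k : ℕ} (M M' : Fin k → LayerModel X A ρ)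
    (π : Fin k → X → PMF A) (hM : ValuesLeOne M π) (x : X) :
    truncValue M π x ≤ truncValue M' π x + simError M M' π x := by
  induction k generalizing x with
  | zero => simp [truncValue]
  | succ k ih =>
    rw [truncValue_succ, truncValue_succ, simError_succ,
      ← lintegral_add_left Measurable.of_discrete]
    refine lintegral_mono fun a => ?_
    have hm : Measurable fun y : ℝ × X => truncReward y +
        truncValue (fun i => M i.succ) (fun i => π i.succ) y.2 :=
      measurable_truncReward.add (measurable_of_snd _)
    have hm' : Measurable fun y : ℝ × X => truncReward y +
        truncValue (fun i => M' i.succ) (fun i => π i.succ) y.2 :=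
      measurable_truncReward.add (measurable_of_snd _)
    refine (lintegral_law_le_add (M 0) (M' 0) (x, a) hm (c := 2)
      (truncReward_add_le_two hM.2.truncValue_le_one)).trans ?_
    rw [add_comm (2 * _), ← add_assoc, ← lintegral_add_left hm']
    refine add_le_add (lintegral_mono fun y => ?_) le_rfl
    rw [add_assoc]
    exact add_le_add le_rfl (ih _ _ _ hM.2 y.2)

theorem truncValue_le_add_simError' {k : ℕ} (M M' : Fin k → LayerModel X A ρ)
    (π : Fin k → X → PMF A) (hM : ValuesLeOne M π) (x : X) :
    truncValue M' π x ≤ truncValue M π x + simError M M' π x := by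
  induction k generalizing x with
  | zero => simp [truncValue]
  | succ k ih =>
    rw [truncValue_succ, truncValue_succ, simError_succ,
      ← lintegral_add_left Measurable.of_discrete]
    refine lintegral_mono fun a => ?_
    have hm : Measurable fun y : ℝ × X => truncReward y +
        truncValue (fun i => M i.succ) (fun i => π i.succ) y.2 :=
      measurable_truncReward.add (measurable_of_snd _)
    have h1 := lintegral_law_le_add (M' 0) (M 0) (x, a) hm (c := 2)
      (truncReward_add_le_two hM.2.truncValue_le_one)
    rw [l1Dist_comm] at h1
    rw [← add_assoc]
    refine le_trans ?_ (add_le_add h1 le_rfl)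
    rw [← lintegral_add_left hm]
    refine lintegral_mono fun y => ?_
    simp only
    rw [add_assoc]
    exact add_le_add le_rfl (ih _ _ _ hM.2 y.2)

end MDP

end

noncomputable section

section MDP

variable {X A : Type*} [MeasurableSpace X] [MeasurableSpace A] {ρ : Measure ℝ}

/-! ### Real-valued values in terms of truncated values -/

theorem measurable_totalReward {k : ℕ} :
    Measurable (totalReward : (Fin k → Sample X A) → ℝ) :=
  Finset.measurable_sum _ fun i _ =>
    measurable_fst.comp (measurable_snd.comp (measurable_pi_apply i))

theorem ofReal_totalReward_eq {k : ℕ} {τ : Fin k → Sample X A}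
    (h : ∀ i, (τ i).2.1 ∈ Set.Icc (0 : ℝ) 1) :
    ENNReal.ofReal (totalReward τ) = ∑ i, truncReward (τ i).2 := by
  rw [totalReward, ENNReal.ofReal_sum_of_nonneg fun i _ => (h i).1]
  refine Finset.sum_congr rfl fun i _ => ?_
  rw [truncReward, min_eq_left]
  exact ENNReal.ofReal_le_one.2 (h i).2

variable [Countable X] [DiscreteMeasurableSpace X] [Countable A] [DiscreteMeasurableSpace A]

theorem ae_reward_mem_Icc {k : ℕ} {M : Fin k → LayerModel X A ρ}
    (hM : ∀ i x a, ∀ᵐ y ∂((M i).law x a), y.1 ∈ Set.Icc (0 : ℝ) 1)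
    (π : Fin k → X → PMF A) (x : X) :
    ∀ᵐ τ ∂(trajFrom M π x), ∀ i, (τ i).2.1 ∈ Set.Icc (0 : ℝ) 1 := by
  rw [ae_all_iff]
  intro i
  have hs : MeasurableSet {s : Sample X A | s.2.1 ∉ Set.Icc (0 : ℝ) 1} :=
    ((measurable_fst.comp measurable_snd) measurableSet_Icc).compl
  have h := lintegral_trajFrom_eval M π x i (g := Set.indicator
    {s : Sample X A | s.2.1 ∉ Set.Icc (0 : ℝ) 1} 1) (measurable_one.indicator hs)
  have h0 : ∀ z : X × A, ∫⁻ y, Set.indicator {s : Sample X A | s.2.1 ∉ Set.Icc (0 : ℝ) 1} 1 (z, y)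
      ∂((M i).law z.1 z.2) = (0 : ℝ≥0∞) := by
    intro z
    refine (lintegral_congr_ae ?_).trans lintegral_zero
    filter_upwards [hM i z.1 z.2] with y hy
    exact Set.indicator_of_notMem (by simp only [Set.mem_ofPred_eq, not_not]; exact hy) _
  simp only [h0, lintegral_zero] at h
  have hs' : MeasurableSet {τ : Fin k → Sample X A | (τ i).2.1 ∉ Set.Icc (0 : ℝ) 1} :=
    ((measurable_fst.comp (measurable_snd.comp (measurable_pi_apply i))) measurableSet_Icc).compl
  rw [ae_iff, ← lintegral_indicator_one hs']
  exact h

theorem integral_totalReward_trajFrom {k : ℕ} {M : Fin k → LayerModel X A ρ}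
    (hM : ∀ i x a, ∀ᵐ y ∂((M i).law x a), y.1 ∈ Set.Icc (0 : ℝ) 1)
    (π : Fin k → X → PMF A) (x : X) :
    ∫ τ, totalReward τ ∂(trajFrom M π x) = (truncValue M π x).toReal := by
  rw [integral_eq_lintegral_of_nonneg_ae _ measurable_totalReward.aestronglyMeasurable]
  · congr 1
    refine lintegral_congr_ae ?_
    filter_upwards [ae_reward_mem_Icc hM π x] with τ hτ
    exact ofReal_totalReward_eq hτ
  · filter_upwards [ae_reward_mem_Icc hM π x] with τ hτ
    exact Finset.sum_nonneg fun i _ => (hτ i).1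

theorem truncValue_le_one_of_ae {k : ℕ} {M : Fin k → LayerModel X A ρ}
    (hM : ∀ i x a, ∀ᵐ y ∂((M i).law x a), y.1 ∈ Set.Icc (0 : ℝ) 1)
    (π : Fin k → X → PMF A) (x : X)
    (h : ∀ᵐ τ ∂(trajFrom M π x), totalReward τ ∈ Set.Icc (0 : ℝ) 1) :
    truncValue M π x ≤ 1 := by
  calc truncValue M π x ≤ ∫⁻ _, 1 ∂(trajFrom M π x) := by
        refine lintegral_mono_ae ?_
        filter_upwards [ae_reward_mem_Icc hM π x, h] with τ hτ hτ'
        rw [← ofReal_totalReward_eq hτ]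
        exact ENNReal.ofReal_le_one.2 hτ'.2
    _ = 1 := by simp

variable {H : ℕ}

theorem NormalizedRewards.valuesLeOne_tail {M : Model X A ρ H} (hM : NormalizedRewards M)
    (π : Policy X A H) : ∀ (l j : ℕ) (h : j + l = H),
      ValuesLeOne (fun i : Fin l => M ⟨j + i, by omega⟩) (fun i : Fin l => π ⟨j + i, by omega⟩)
  | 0, _, _ => trivial
  | l + 1, j, h => by
    refine ⟨fun x => ?_, ?_⟩
    · have hl : l + 1 = H - j := by omega
      refine truncValue_le_one_of_ae (fun i => hM.1 _) _ _ ?_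
      have key : ∀ (n : ℕ) (hn : H - j = n), ∀ᵐ τ ∂(trajFrom
          (fun i : Fin n => M ⟨j + i, by omega⟩) (fun i : Fin n => π ⟨j + i, by omega⟩) x),
          totalReward τ ∈ Set.Icc (0 : ℝ) 1 := by
        rintro n rfl
        exact hM.2 π ⟨j, by omega⟩ x
      exact key _ hl.symm
    · have := hM.valuesLeOne_tail π l (j + 1) (by omega)
      have e : ∀ i : Fin l, j + ((i.succ : Fin (l + 1)) : ℕ) = j + 1 + i := fun i => by
        simp only [Fin.val_succ]; omega
      simp only [e]
      exact this

theorem NormalizedRewards.valuesLeOne {M : Model X A ρ H} (hM : NormalizedRewards M)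
    (π : Policy X A H) : ValuesLeOne M π := by
  have := hM.valuesLeOne_tail π H 0 (zero_add H)
  simpa only [zero_add] using this

theorem fromLayer_zero {α : Type*} (f : Fin H → α) (h : 0 < H) : fromLayer f ⟨0, h⟩ = f := by
  funext i
  exact congrArg f (Fin.ext (Nat.zero_add _))

theorem NormalizedRewards.valueFn_zero {M : Model X A ρ H} (hM : NormalizedRewards M)
    (π : Policy X A H) (h : 0 < H) (x : X) :
    valueFn M π ⟨0, h⟩ x = (truncValue M π x).toReal := by
  unfold valueFn
  have e1 : fromLayer M ⟨0, h⟩ = M := fromLayer_zero M h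
  have e2 : fromLayer π ⟨0, h⟩ = π := fromLayer_zero π h
  rw [e1, e2]
  exact integral_totalReward_trajFrom hM.1 π x

/-- Expected total truncated reward. -/
def truncReturn (M : Model X A ρ H) (d₁ : PMF X) (π : Policy X A H) : ℝ≥0∞ :=
  ∫⁻ x, truncValue M π x ∂d₁.toMeasure

theorem NormalizedRewards.truncReturn_le_one {M : Model X A ρ H} (hM : NormalizedRewards M)
    (d₁ : PMF X) (π : Policy X A H) : truncReturn M d₁ π ≤ 1 :=
  calc truncReturn M d₁ π ≤ ∫⁻ _, 1 ∂d₁.toMeasure :=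
        lintegral_mono fun x => (hM.valuesLeOne π).truncValue_le_one x
    _ = 1 := by simp

theorem NormalizedRewards.expReward_eq {M : Model X A ρ H} (hM : NormalizedRewards M)
    (d₁ : PMF X) (π : Policy X A H) :
    expReward M d₁ π = (truncReturn M d₁ π).toReal := by
  have hs : MeasurableSet {τ : Round X A H | ¬ ∀ i, (τ i).2.1 ∈ Set.Icc (0 : ℝ) 1} := by
    refine (measurableSet_setOfPred.2 ?_).compl
    exact Measurable.forall fun i => measurableSet_setOfPred.1
      ((measurable_fst.comp (measurable_snd.comp (measurable_pi_apply i))) measurableSet_Icc)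
  have hae : ∀ᵐ τ ∂(trajLaw M d₁ π), ∀ i, (τ i).2.1 ∈ Set.Icc (0 : ℝ) 1 := by
    rw [ae_iff, ← lintegral_indicator_one hs, lintegral_trajLaw _ _ _ (measurable_one.indicator hs)]
    simp_rw [lintegral_indicator_one hs]
    have : ∀ x, trajFrom M π x {τ | ¬ ∀ i, (τ i).2.1 ∈ Set.Icc (0 : ℝ) 1} = 0 := fun x =>
      ae_iff.1 (ae_reward_mem_Icc hM.1 π x)
    simp only [this, lintegral_zero]
  rw [expReward, integral_eq_lintegral_of_nonneg_ae _ measurable_totalReward.aestronglyMeasurable]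
  · congr 1
    rw [truncReturn]
    unfold truncValue
    rw [← lintegral_trajLaw _ _ _ measurable_sum_truncReward]
    refine lintegral_congr_ae ?_
    filter_upwards [hae] with τ hτ
    exact ofReal_totalReward_eq hτ
  · filter_upwards [hae] with τ hτ
    exact Finset.sum_nonneg fun i _ => (hτ i).1

theorem NormalizedRewards.expReward_mem_Icc {M : Model X A ρ H} (hM : NormalizedRewards M)
    (d₁ : PMF X) (π : Policy X A H) : expReward M d₁ π ∈ Set.Icc (0 : ℝ) 1 := by
  rw [hM.expReward_eq]
  refine ⟨ENNReal.toReal_nonneg, ?_⟩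
  exact ENNReal.toReal_le_of_le_ofReal zero_le_one (by simpa using hM.truncReturn_le_one d₁ π)

theorem lintegral_simError (M M' : Model X A ρ H) (d₁ : PMF X) (π : Policy X A H) :
    ∫⁻ x, simError M M' π x ∂d₁.toMeasure =
      ∑ h, ∑' z, occupancy M' d₁ π h z * (2 * l1Dist (M h) (M' h) z) := by
  unfold simError
  rw [← lintegral_trajLaw _ _ _ (measurable_sum_l1Dist M M'), lintegral_finsetSum]
  · exact Finset.sum_congr rfl fun h _ =>
      lintegral_trajLaw_fst M' d₁ π h fun z => 2 * l1Dist (M h) (M' h) z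
  · exact fun h _ => (Measurable.of_discrete (f := fun z => 2 * l1Dist (M h) (M' h) z)).comp
      (measurable_fst.comp (measurable_pi_apply h))

/-- An optimal policy of `M` is optimal for the expected total reward. -/
theorem IsOptimalFor.truncReturn_le {M : Model X A ρ H} (hM : NormalizedRewards M)
    {π : DetPolicy X A H} (hπ : IsOptimalFor M π) (d₁ : PMF X) (π' : Policy X A H) :
    truncReturn M d₁ π' ≤ truncReturn M d₁ π.toPolicy := by
  rcases Nat.eq_zero_or_pos H with rfl | h
  · simp [truncReturn, truncValue]
  refine lintegral_mono fun x => ?_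
  have := hπ π' ⟨0, h⟩ x
  rw [hM.valueFn_zero, hM.valueFn_zero] at this
  exact (ENNReal.toReal_le_toReal
    (((hM.valuesLeOne _).truncValue_le_one x).trans_lt ENNReal.one_lt_top).ne
    (((hM.valuesLeOne _).truncValue_le_one x).trans_lt ENNReal.one_lt_top).ne).1 this

/-- The suboptimality of the optimal policy of a misspecified model. -/
theorem ofReal_expReward_sub_le {M M' : Model X A ρ H} (hM : NormalizedRewards M)
    (hM' : NormalizedRewards M') {π : DetPolicy X A H} (hπ : IsOptimalFor M π) (d₁ : PMF X)
    (π' : Policy X A H) :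
    ENNReal.ofReal (expReward M' d₁ π' - expReward M' d₁ π.toPolicy) ≤
      ∑ h, ((∑' z, occupancy M' d₁ π' h z * (2 * l1Dist (M h) (M' h) z)) +
        ∑' z, occupancy M' d₁ π.toPolicy h z * (2 * l1Dist (M h) (M' h) z)) := by
  have h1 : truncReturn M' d₁ π' ≤ truncReturn M d₁ π' +
      ∫⁻ x, simError M M' π' x ∂d₁.toMeasure := by
    rw [truncReturn, truncReturn, ← lintegral_add_left Measurable.of_discrete]
    exact lintegral_mono fun x => truncValue_le_add_simError' M M' π' (hM.valuesLeOne _) x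
  have h2 : truncReturn M d₁ π.toPolicy ≤ truncReturn M' d₁ π.toPolicy +
      ∫⁻ x, simError M M' π.toPolicy x ∂d₁.toMeasure := by
    rw [truncReturn, truncReturn, ← lintegral_add_left Measurable.of_discrete]
    exact lintegral_mono fun x => truncValue_le_add_simError M M' π.toPolicy (hM.valuesLeOne _) x
  have h3 := hπ.truncReturn_le hM d₁ π'
  rw [Finset.sum_add_distrib, ← lintegral_simError, ← lintegral_simError, hM'.expReward_eq,
    hM'.expReward_eq, ENNReal.ofReal_sub _ ENNReal.toReal_nonneg,
    ENNReal.ofReal_toReal ((hM'.truncReturn_le_one _ _).trans_lt ENNReal.one_lt_top).ne,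
    ENNReal.ofReal_toReal ((hM'.truncReturn_le_one _ _).trans_lt ENNReal.one_lt_top).ne,
    tsub_le_iff_left]
  calc truncReturn M' d₁ π' ≤ _ := h1
    _ ≤ _ := add_le_add (h3.trans h2) le_rfl
    _ = _ := by ring

/-! ### Change of measure -/

/-- Clipped concentrability at scale `γ` of `d` with respect to unnormalized weights `w`, divided
by `γ`. -/
def clipSum (d w : X × A → ℝ≥0∞) (γ : ℝ≥0) : ℝ≥0∞ := ∑' z, d z * min (d z / (γ * w z)) 1

theorem mul_l1Dist_le (m m' : LayerModel X A ρ) (z : X × A) {d w : ℝ≥0∞} (hd : d ≠ ∞)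
    (hw : w ≠ ∞) {γ : ℝ≥0} (hγ : 0 < γ) :
    d * (2 * l1Dist m m' z) ≤ 4 * (d * min (d / (γ * w)) 1) + γ * (w * hellSq m m' z) := by
  rcases le_or_gt 1 (d / (γ * w)) with h1 | h1
  · rw [min_eq_right h1, mul_one]
    refine le_add_right ?_
    calc d * (2 * l1Dist m m' z) ≤ d * (2 * 2) := by gcongr; exact l1Dist_le_two m m' z
      _ = 4 * d := by rw [mul_comm]; norm_num
  rcases eq_or_ne d 0 with rfl | hd0
  · simp
  have hw0 : w ≠ 0 := by
    rintro rfl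
    rw [mul_zero, ENNReal.div_zero hd0] at h1
    exact absurd h1 (by simp)
  lift d to ℝ≥0 using hd
  lift w to ℝ≥0 using hw
  have hd' : 0 < d := pos_iff_ne_zero.2 (by exact_mod_cast hd0)
  have hw' : 0 < w := pos_iff_ne_zero.2 (by exact_mod_cast hw0)
  rw [min_eq_left h1.le]
  have hβ : 0 < d / (γ * w) := by positivity
  have hb := l1Dist_le_hellSq m m' z hβ
  have hf : hellSq m m' z ≠ ∞ := ((hellSq_le_two m m' z).trans_lt (by norm_num)).ne
  lift hellSq m m' z to ℝ≥0 using hf with s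
  have e : ((d : ℝ≥0∞) / (γ * w)) = ((d / (γ * w) : ℝ≥0) : ℝ≥0∞) := by
    rw [ENNReal.coe_div (by positivity), ENNReal.coe_mul]
  rw [e]
  calc (d : ℝ≥0∞) * (2 * l1Dist m m' z)
      ≤ d * (2 * (s / (2 * ((d / (γ * w) : ℝ≥0) : ℝ≥0∞)) + 2 * ((d / (γ * w) : ℝ≥0) : ℝ≥0∞))) := by
        gcongr
    _ = ((d * (2 * (s / (2 * (d / (γ * w))) + 2 * (d / (γ * w)))) : ℝ≥0) : ℝ≥0∞) := by
        push_cast [ENNReal.coe_div (show 2 * (d / (γ * w)) ≠ 0 by positivity)]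
        rfl
    _ ≤ ((4 * (d * (d / (γ * w))) + γ * (w * s) : ℝ≥0) : ℝ≥0∞) := by
        rw [ENNReal.coe_le_coe]
        apply le_of_eq
        field_simp
        ring
    _ = _ := by push_cast; rfl

theorem tsum_mul_l1Dist_le (m m' : LayerModel X A ρ) {d w : X × A → ℝ≥0∞} (hd : ∀ z, d z ≠ ∞)
    (hw : ∀ z, w z ≠ ∞) {γ : ℝ≥0} (hγ : 0 < γ) :
    ∑' z, d z * (2 * l1Dist m m' z) ≤
      4 * clipSum d w γ + γ * ∑' z, w z * hellSq m m' z := by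
  rw [clipSum, ← ENNReal.tsum_mul_left, ← ENNReal.tsum_mul_left, ← ENNReal.tsum_add]
  exact ENNReal.tsum_le_tsum fun z => mul_l1Dist_le m m' z (hd z) (hw z) hγ

theorem occupancy_ne_top (M : Model X A ρ H) (d₁ : PMF X) (π : Policy X A H) (h : Fin H)
    (z : X × A) : occupancy M d₁ π h z ≠ ∞ := measure_ne_top _ _

/-- The suboptimality of the optimal policy of a misspecified model, in terms of the squared
Hellinger error under arbitrary weights. -/
theorem ofReal_expReward_sub_le_clipSum {M M' : Model X A ρ H} (hM : NormalizedRewards M)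
    (hM' : NormalizedRewards M') {π : DetPolicy X A H} (hπ : IsOptimalFor M π) (d₁ : PMF X)
    (π' : Policy X A H) {w : Fin H → X × A → ℝ≥0∞} (hw : ∀ h z, w h z ≠ ∞) {γ : ℝ≥0}
    (hγ : 0 < γ) :
    ENNReal.ofReal (expReward M' d₁ π' - expReward M' d₁ π.toPolicy) ≤
      ∑ h, (4 * (clipSum (occupancy M' d₁ π' h) (w h) γ +
        clipSum (occupancy M' d₁ π.toPolicy h) (w h) γ) +
          2 * γ * ∑' z, w h z * hellSq (M h) (M' h) z) := by
  refine (ofReal_expReward_sub_le hM hM' hπ d₁ π').trans (Finset.sum_le_sum fun h _ => ?_)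
  refine (add_le_add (tsum_mul_l1Dist_le (M h) (M' h) (occupancy_ne_top M' d₁ π' h) (hw h) hγ)
    (tsum_mul_l1Dist_le (M h) (M' h) (occupancy_ne_top M' d₁ π.toPolicy h) (hw h) hγ)).trans
      (le_of_eq ?_)
  ring

end MDP

end

noncomputable section

section MDP

variable {X A : Type*} [MeasurableSpace X] [MeasurableSpace A] {ρ : Measure ℝ}

/-! ### Likelihood ratios -/

/-- Density of a layer model at a sample. -/
def LayerModel.sampleDens (m : LayerModel X A ρ) (s : Sample X A) : ℝ≥0 := m.dens s.1.1 s.1.2 s.2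

/-- Square root of the likelihood ratio of two layer models. -/
def sqrtLikRatio (m m' : LayerModel X A ρ) (s : Sample X A) : ℝ≥0∞ :=
  (NNReal.sqrt (m.sampleDens s / m'.sampleDens s) : ℝ≥0)

/-- Half the mean squared Hellinger distance of two layer models under the weights `μ`. -/
def hellGain (μ : X × A → ℝ≥0∞) (m m' : LayerModel X A ρ) : ℝ≥0∞ :=
  ∑' z, μ z * (hellSq m m' z / 2)

/-- The exponential of an extended nonnegative real (with junk value at `∞`). -/
def expENN (e : ℝ≥0∞) : ℝ≥0∞ := ENNReal.ofReal (Real.exp e.toReal)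

theorem measurable_expENN : Measurable expENN :=
  ENNReal.measurable_ofReal.comp (Real.measurable_exp.comp ENNReal.measurable_toReal)

theorem prod_expENN {ι : Type*} (s : Finset ι) (e : ι → ℝ≥0∞) (he : ∀ i ∈ s, e i ≠ ∞) :
    ∏ i ∈ s, expENN (e i) = expENN (∑ i ∈ s, e i) := by
  unfold expENN
  rw [ENNReal.toReal_sum he, Real.exp_sum, ENNReal.ofReal_prod_of_nonneg]
  exact fun i _ => (Real.exp_pos _).le

theorem mul_expENN_le_one {b e : ℝ≥0∞} (h : b + e = 1) : b * expENN e ≤ 1 := by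
  have hb : b ≠ ∞ := by rintro rfl; simp at h
  have he : e ≠ ∞ := by rintro rfl; simp at h
  have h1 : b.toReal + e.toReal = 1 := by
    rw [← ENNReal.toReal_add hb he, h]; rfl
  rw [← ENNReal.ofReal_toReal hb, expENN, ← ENNReal.ofReal_mul ENNReal.toReal_nonneg,
    ENNReal.ofReal_le_one]
  have h2 := Real.one_sub_le_exp_neg e.toReal
  have h3 := Real.exp_pos e.toReal
  have h4 : Real.exp (-e.toReal) * Real.exp e.toReal = 1 := by rw [← Real.exp_add]; simp
  nlinarith

theorem hellGain_le_one {μ : X × A → ℝ≥0∞} (hμ : ∑' z, μ z = 1) (m m' : LayerModel X A ρ) :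
    hellGain μ m m' ≤ 1 := by
  rw [← hμ]
  refine ENNReal.tsum_le_tsum fun z => mul_le_of_le_one_right' ?_
  rw [← bhatt_add_half_hellSq m m' z]
  exact le_add_self

theorem hellGain_ne_top {μ : X × A → ℝ≥0∞} (hμ : ∑' z, μ z = 1) (m m' : LayerModel X A ρ) :
    hellGain μ m m' ≠ ∞ := ((hellGain_le_one hμ m m').trans_lt ENNReal.one_lt_top).ne

theorem tsum_mul_bhatt_add_hellGain {μ : X × A → ℝ≥0∞} (hμ : ∑' z, μ z = 1)
    (m m' : LayerModel X A ρ) : ∑' z, μ z * bhatt m m' z + hellGain μ m m' = 1 := by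
  rw [hellGain, ← ENNReal.tsum_add, ← hμ]
  refine tsum_congr fun z => ?_
  rw [← mul_add, bhatt_add_half_hellSq, mul_one]

/-- `s` is distributed as a sample with state-action distribution `μ` and transitions from `m`. -/
def HasSampleLaw {Ω : Type*} [MeasurableSpace Ω] (P : Measure Ω) (s : Ω → Sample X A)
    (μ : X × A → ℝ≥0∞) (m : LayerModel X A ρ) : Prop :=
  ∀ g : Sample X A → ℝ≥0∞, Measurable g →
    ∫⁻ ω, g (s ω) ∂P = ∑' z, μ z * ∫⁻ y, g (z, y) ∂(m.law z.1 z.2)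

variable [Countable X] [DiscreteMeasurableSpace X] [Countable A] [DiscreteMeasurableSpace A]

theorem LayerModel.measurable_sampleDens (m : LayerModel X A ρ) : Measurable m.sampleDens :=
  measurable_from_prod_countable_right fun z => m.measurable_dens z.1 z.2

theorem measurable_sqrtLikRatio (m m' : LayerModel X A ρ) : Measurable (sqrtLikRatio m m') :=
  (NNReal.continuous_sqrt.measurable.comp
    (m.measurable_sampleDens.div m'.measurable_sampleDens)).coe_nnreal_ennreal

theorem lintegral_sqrtLikRatio_le (m m' : LayerModel X A ρ) (z : X × A) :
    ∫⁻ y, sqrtLikRatio m m' (z, y) ∂(m'.law z.1 z.2) ≤ bhatt m m' z := by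
  have hm : Measurable fun y => sqrtLikRatio m m' (z, y) :=
    (measurable_sqrtLikRatio m m').comp measurable_prodMk_left
  rw [m'.lintegral_law _ _ hm]
  refine lintegral_mono fun y => ?_
  simp only [sqrtLikRatio, LayerModel.sampleDens]
  rw [← ENNReal.coe_mul, ENNReal.coe_le_coe]
  set p := m.dens z.1 z.2 y
  set q := m'.dens z.1 z.2 y
  rw [NNReal.sqrt_div]
  rcases eq_or_ne (NNReal.sqrt q) 0 with h | h
  · simp [NNReal.sqrt_eq_zero.1 h]
  · apply le_of_eq
    conv_lhs => rw [← NNReal.mul_self_sqrt q]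
    field_simp
    rw [NNReal.sqrt_sq, mul_comm]

theorem HasSampleLaw.lintegral_mul_expENN_le {Ω : Type*} [MeasurableSpace Ω] {P : Measure Ω}
    {s : Ω → Sample X A} {μ : X × A → ℝ≥0∞} {m' : LayerModel X A ρ}
    (h : HasSampleLaw P s μ m') (hμ : ∑' z, μ z = 1) (m : LayerModel X A ρ) :
    (∫⁻ ω, sqrtLikRatio m m' (s ω) ∂P) * expENN (hellGain μ m m') ≤ 1 := by
  rw [h _ (measurable_sqrtLikRatio m m')]
  refine le_trans ?_ (mul_expENN_le_one (tsum_mul_bhatt_add_hellGain hμ m m'))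
  gcongr with z
  exact lintegral_sqrtLikRatio_le m m' z

/-- Infinite where the density vanishes, and zero elsewhere. -/
def LayerModel.vanishing (m : LayerModel X A ρ) (s : Sample X A) : ℝ≥0∞ :=
  open Classical in if m.sampleDens s = 0 then ∞ else 0

theorem LayerModel.measurable_vanishing (m : LayerModel X A ρ) : Measurable m.vanishing := by
  classical
  exact Measurable.ite (m.measurable_sampleDens (measurableSet_singleton 0)) measurable_const
    measurable_const

theorem HasSampleLaw.lintegral_vanishing {Ω : Type*} [MeasurableSpace Ω] {P : Measure Ω}
    {s : Ω → Sample X A} {μ : X × A → ℝ≥0∞} {m : LayerModel X A ρ}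
    (h : HasSampleLaw P s μ m) : ∫⁻ ω, m.vanishing (s ω) ∂P = 0 := by
  rw [h _ m.measurable_vanishing]
  refine ENNReal.tsum_eq_zero.2 fun z => ?_
  have hm : Measurable fun y => m.vanishing (z, y) :=
    m.measurable_vanishing.comp measurable_prodMk_left
  rw [m.lintegral_law _ _ hm]
  have : ∀ y, (m.dens z.1 z.2 y : ℝ≥0∞) * m.vanishing (z, y) = 0 := by
    intro y
    by_cases hy : m.dens z.1 z.2 y = 0
    · simp [hy]
    · simp [LayerModel.vanishing, LayerModel.sampleDens, hy]
  simp [this]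

theorem hasSampleLaw_of_map_eq {Ω : Type*} [MeasurableSpace Ω] {P : Measure Ω}
    {s : Ω → Sample X A} (hs : Measurable s) {p : PMF (X × A)} {m : LayerModel X A ρ}
    (h : P.map s = sampleLaw p m) : HasSampleLaw P s p m := fun g hg => by
  rw [← lintegral_sampleLaw p m hg, ← h, lintegral_map hg hs]

theorem hasSampleLaw_trajLaw {H : ℕ} (M : Model X A ρ H) (d₁ : PMF X) (π : Policy X A H)
    (h : Fin H) : HasSampleLaw (trajLaw M d₁ π) (fun τ => τ h) (occupancy M d₁ π h) (M h) :=
  fun _ hg => lintegral_trajLaw_eval M d₁ π h hg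

/-- Deviation inequality for likelihood ratios. -/
theorem measure_prod_le_and_lt_sum_le {Ω ι : Type*} [MeasurableSpace Ω] [Fintype ι]
    (P : Measure Ω) (m m' : ι → LayerModel X A ρ) (s : ι → Ω → Sample X A) (e : ι → Ω → ℝ≥0∞)
    (he : ∀ i ω, e i ω ≠ ∞) (hs : ∀ i, Measurable (s i)) (hem : ∀ i, Measurable (e i))
    (hpos : ∫⁻ ω, ∑ i, (m' i).vanishing (s i ω) ∂P = 0)
    (hF : ∫⁻ ω, ∏ i, (sqrtLikRatio (m i) (m' i) (s i ω) * expENN (e i ω)) ∂P ≤ 1) (L : ℝ) :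
    P {ω | ∏ i, (m' i).sampleDens (s i ω) ≤ ∏ i, (m i).sampleDens (s i ω) ∧
      ENNReal.ofReal L < ∑ i, e i ω} ≤ ENNReal.ofReal (Real.exp (-L)) := by
  have hmeas : Measurable fun ω => ∏ i, (sqrtLikRatio (m i) (m' i) (s i ω) * expENN (e i ω)) :=
    Finset.measurable_prod _ fun i _ =>
      ((measurable_sqrtLikRatio _ _).comp (hs i)).mul (measurable_expENN.comp (hem i))
  have hvm : Measurable fun ω => ∑ i, (m' i).vanishing (s i ω) :=
    Finset.measurable_sum _ fun i _ => (m' i).measurable_vanishing.comp (hs i)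
  have hae : ∀ᵐ ω ∂P, ∀ i, (m' i).sampleDens (s i ω) ≠ 0 := by
    filter_upwards [(lintegral_eq_zero_iff hvm).1 hpos] with ω hω i hi
    have := (Finset.sum_eq_zero_iff.1 hω) i (Finset.mem_univ i)
    simp [LayerModel.vanishing, hi] at this
  set c := ENNReal.ofReal (Real.exp L)
  have hsub : {ω | ∏ i, (m' i).sampleDens (s i ω) ≤ ∏ i, (m i).sampleDens (s i ω) ∧
      ENNReal.ofReal L < ∑ i, e i ω} ≤ᵐ[P]
      {ω | c ≤ ∏ i, (sqrtLikRatio (m i) (m' i) (s i ω) * expENN (e i ω))} := by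
    filter_upwards [hae] with ω hω hmem
    obtain ⟨h1, h2⟩ := hmem
    change c ≤ _
    rw [Finset.prod_mul_distrib, prod_expENN _ _ fun i _ => he i ω]
    have h3 : (1 : ℝ≥0∞) ≤ ∏ i, sqrtLikRatio (m i) (m' i) (s i ω) := by
      unfold sqrtLikRatio
      rw [← ENNReal.ofNNReal_finsetProd, ← ENNReal.coe_one, ENNReal.coe_le_coe]
      have : ∏ i, NNReal.sqrt ((m i).sampleDens (s i ω) / (m' i).sampleDens (s i ω)) =
          NNReal.sqrt (∏ i, ((m i).sampleDens (s i ω) / (m' i).sampleDens (s i ω))) :=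
        (map_prod NNReal.sqrtHom _ _).symm
      rw [this, Finset.prod_div_distrib, NNReal.one_le_sqrt]
      rwa [one_le_div (pos_iff_ne_zero.2 (Finset.prod_ne_zero_iff.2 fun i _ => hω i))]
    have hsum : ∑ i, e i ω ≠ ∞ := ENNReal.sum_ne_top.2 fun i _ => he i ω
    have h4 : c ≤ expENN (∑ i, e i ω) := by
      refine ENNReal.ofReal_le_ofReal (Real.exp_le_exp.2 ?_)
      exact (ENNReal.ofReal_le_iff_le_toReal hsum).1 h2.le
    calc c = 1 * c := (one_mul c).symm
      _ ≤ _ := mul_le_mul' h3 h4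
  refine (measure_mono_ae hsub).trans ((meas_ge_le_lintegral_div hmeas.aemeasurable
    (by simp [Real.exp_pos]) ENNReal.ofReal_ne_top).trans ?_)
  refine (ENNReal.div_le_div_right hF _).trans (le_of_eq ?_)
  rw [one_div, ← ENNReal.ofReal_inv_of_pos (Real.exp_pos L), Real.exp_neg]

/-! ### Maximum likelihood -/

variable {H : ℕ}

theorem logLik_eq {n : ℕ} (D : Fin n → Round X A H) (h : Fin H) (m : LayerModel X A ρ) :
    logLik D h m = ENNReal.log ((∏ i, m.sampleDens (D i h) : ℝ≥0) : ℝ≥0∞) := by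
  have : ∀ s : Finset (Fin n), ∑ i ∈ s, ENNReal.log (m.sampleDens (D i h) : ℝ≥0∞) =
      ENNReal.log ((∏ i ∈ s, m.sampleDens (D i h) : ℝ≥0) : ℝ≥0∞) := by
    intro s
    induction s using Finset.cons_induction with
    | empty => simp
    | cons a s ha ih => rw [Finset.sum_cons, Finset.prod_cons, ENNReal.coe_mul,
        ENNReal.log_mul_add, ih]
  exact this Finset.univ

theorem IsMLE.prod_sampleDens_le {𝓜 : Fin H → Finset (LayerModel X A ρ)} {n : ℕ}
    {D : Fin n → Round X A H} {Mhat : Model X A ρ H} (hM : IsMLE 𝓜 D Mhat) {h : Fin H}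
    {m : LayerModel X A ρ} (hm : m ∈ 𝓜 h) :
    ∏ i, m.sampleDens (D i h) ≤ ∏ i, (Mhat h).sampleDens (D i h) := by
  have := (hM h).2 m hm
  rw [logLik_eq, logLik_eq] at this
  exact ENNReal.coe_le_coe.1 (ENNReal.log_le_log_iff.1 this)

end MDP

end

noncomputable section

section MDP

variable {X A : Type*} [MeasurableSpace X] [MeasurableSpace A] {ρ : Measure ℝ}
variable [Countable X] [DiscreteMeasurableSpace X] [Countable A] [DiscreteMeasurableSpace A]
variable {H : ℕ}

/-! ### Maximum likelihood on adaptively collected data -/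

theorem measurable_firstElems {E : Type*} [MeasurableSpace E] {n : ℕ} (i : ℕ) (hi : i ≤ n) :
    Measurable fun D : Fin n → E => firstElems D i hi :=
  measurable_pi_iff.2 fun j => measurable_pi_apply (Fin.castLE hi j)

theorem HasSampleLaw.measure_fst_eq {Ω : Type*} [MeasurableSpace Ω] {P : Measure Ω}
    {s : Ω → Sample X A} (hs : Measurable s) {μ : X × A → ℝ≥0∞} {m : LayerModel X A ρ}
    (h : HasSampleLaw P s μ m) (z : X × A) : P {ω | (s ω).1 = z} = μ z := by
  classical
  have hset : MeasurableSet {s : Sample X A | s.1 = z} :=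
    measurable_fst (measurableSet_singleton z)
  have hset' : MeasurableSet {ω | (s ω).1 = z} := (measurable_fst.comp hs) (measurableSet_singleton z)
  have := h (Set.indicator {s : Sample X A | s.1 = z} 1) (measurable_one.indicator hset)
  rw [← lintegral_indicator_one hset']
  refine this.trans ?_
  rw [tsum_eq_single z]
  · simp
  · intro z' hz'
    have : ∀ y, Set.indicator {s : Sample X A | s.1 = z} (1 : Sample X A → ℝ≥0∞) (z', y) = 0 :=
      fun y => by simp [Set.indicator, hz']
    simp [this]

theorem measurable_hellGain {Ω : Type*} [MeasurableSpace Ω] {μ : Ω → X × A → ℝ≥0∞}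
    (hμ : ∀ z, Measurable fun ω => μ ω z) (m m' : LayerModel X A ρ) :
    Measurable fun ω => hellGain (μ ω) m m' :=
  Measurable.tsum fun z => (hμ z).mul_const _

variable {Mstar : Model X A ρ H}

theorem DataCollection.hasSampleLaw (S : DataCollection Mstar) (i : ℕ) (D : Fin i → Round X A H)
    (h : Fin H) : HasSampleLaw (S.kernel i D) (fun s => s h) (S.dist i D h) (Mstar h) :=
  hasSampleLaw_of_map_eq (measurable_pi_apply h) (S.marginal i D h)

theorem DataCollection.measurable_dist (S : DataCollection Mstar) (i : ℕ) (h : Fin H)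
    (z : X × A) : Measurable fun D => S.dist i D h z := by
  have hset : MeasurableSet {s : Round X A H | (s h).1 = z} :=
    (measurable_fst.comp (measurable_pi_apply h)) (measurableSet_singleton z)
  have := Kernel.measurable_coe (S.kernel i) hset
  have e : (fun D => S.dist i D h z) = fun D => S.kernel i D {s : Round X A H | (s h).1 = z} :=
    funext fun D => ((S.hasSampleLaw i D h).measure_fst_eq (measurable_pi_apply h) z).symm
  rw [e]
  exact this

theorem DataCollection.lintegral_vanishing (S : DataCollection Mstar) (n : ℕ) :
    ∫⁻ D, ∑ i : Fin n, ∑ h : Fin H, (Mstar h).vanishing (D i h) ∂(S.datasetLaw n) = 0 := by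
  refine lintegral_iterLaw_sum_eq_zero _ (fun s : Round X A H => ∑ h, (Mstar h).vanishing (s h)) n
    ?_ (fun i _ D => ?_) (fun i _ D => ?_)
  · exact Finset.measurable_sum _ fun h _ =>
      (Mstar h).measurable_vanishing.comp (measurable_pi_apply h)
  · have := S.markov i
    simp
  · refine (lintegral_finsetSum _ fun h _ =>
      (Mstar h).measurable_vanishing.comp (measurable_pi_apply h)).trans ?_
    exact Finset.sum_eq_zero fun h _ => (S.hasSampleLaw i D h).lintegral_vanishing

/-- Accumulated squared Hellinger error at layer `h` on the data `D`. -/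
def DataCollection.totalGain (S : DataCollection Mstar) {n : ℕ} (D : Fin n → Round X A H)
    (h : Fin H) (m : LayerModel X A ρ) : ℝ≥0∞ :=
  ∑ i : Fin n, hellGain (S.dist i (firstElems D i i.isLt.le) h) m (Mstar h)

theorem DataCollection.measurable_hellGain_dist (S : DataCollection Mstar) {n : ℕ} (i : Fin n)
    (h : Fin H) (m : LayerModel X A ρ) :
    Measurable fun D : Fin n → Round X A H =>
      hellGain (S.dist i (firstElems D i i.isLt.le) h) m (Mstar h) :=
  measurable_hellGain (fun z => (S.measurable_dist i h z).comp (measurable_firstElems _ _)) _ _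

theorem DataCollection.measure_layer_le (S : DataCollection Mstar) (n : ℕ) (h : Fin H)
    (m : LayerModel X A ρ) (L : ℝ) :
    S.datasetLaw n {D | ∏ i, (Mstar h).sampleDens (D i h) ≤ ∏ i, m.sampleDens (D i h) ∧
      ENNReal.ofReal L < S.totalGain D h m} ≤ ENNReal.ofReal (Real.exp (-L)) := by
  refine measure_prod_le_and_lt_sum_le (S.datasetLaw n) (fun _ : Fin n => m) (fun _ => Mstar h)
    (fun i D => D i h)
    (fun i D => hellGain (S.dist i (firstElems D i i.isLt.le) h) m (Mstar h))
    (fun i D => hellGain_ne_top (PMF.tsum_coe _) _ _)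
    (fun i => (measurable_pi_apply h).comp (measurable_pi_apply i))
    (fun i => S.measurable_hellGain_dist i h m) ?_ ?_ L
  · refine le_antisymm ((lintegral_mono fun D => ?_).trans (S.lintegral_vanishing n).le) zero_le
    exact Finset.sum_le_sum fun i _ => Finset.single_le_sum
      (f := fun h => (Mstar h).vanishing (D i h)) (fun _ _ => zero_le) (Finset.mem_univ h)
  · refine lintegral_iterLaw_prod_le_one _ (fun i D s => sqrtLikRatio m (Mstar h) (s h) *
      expENN (hellGain (S.dist i D h) m (Mstar h))) n (fun i _ D => ?_) (fun i _ D => ?_)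
    · exact ((measurable_sqrtLikRatio _ _).comp (measurable_pi_apply h)).mul_const _
    · have hm : Measurable fun s : Round X A H => sqrtLikRatio m (Mstar h) (s h) :=
        (measurable_sqrtLikRatio _ _).comp (measurable_pi_apply h)
      rw [lintegral_mul_const _ hm]
      exact (S.hasSampleLaw i D h).lintegral_mul_expENN_le (PMF.tsum_coe _) m

theorem DataCollection.LayerIndependent.measure_le {S : DataCollection Mstar}
    (hS : S.LayerIndependent) (n : ℕ) (M : Model X A ρ H) (L : ℝ) :
    S.datasetLaw n {D | (∀ h, ∏ i, (Mstar h).sampleDens (D i h) ≤ ∏ i, (M h).sampleDens (D i h)) ∧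
      ENNReal.ofReal L < ∑ h, S.totalGain D h (M h)} ≤ ENNReal.ofReal (Real.exp (-L)) := by
  refine (measure_mono ?_).trans
    (measure_prod_le_and_lt_sum_le (S.datasetLaw n) (fun p : Fin n × Fin H => M p.2)
      (fun p => Mstar p.2) (fun p D => D p.1 p.2)
      (fun p D => hellGain (S.dist p.1 (firstElems D p.1 p.1.isLt.le) p.2) (M p.2) (Mstar p.2))
      (fun p D => hellGain_ne_top (PMF.tsum_coe _) _ _)
      (fun p => (measurable_pi_apply p.2).comp (measurable_pi_apply p.1))
      (fun p => S.measurable_hellGain_dist p.1 p.2 (M p.2)) ?_ ?_ L)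
  · rintro D ⟨h1, h2⟩
    refine ⟨?_, ?_⟩
    · rw [Fintype.prod_prod_type_right, Fintype.prod_prod_type_right]
      exact Finset.prod_le_prod' fun h _ => h1 h
    · rw [Fintype.sum_prod_type_right]
      exact h2
  · simp_rw [Fintype.sum_prod_type]
    exact S.lintegral_vanishing n
  · simp_rw [Fintype.prod_prod_type]
    refine lintegral_iterLaw_prod_le_one _ (fun i D s => ∏ h, (sqrtLikRatio (M h) (Mstar h) (s h) *
      expENN (hellGain (S.dist i D h) (M h) (Mstar h)))) n (fun i _ D => ?_) (fun i _ D => ?_)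
    · exact Finset.measurable_prod _ fun h _ =>
        ((measurable_sqrtLikRatio _ _).comp (measurable_pi_apply h)).mul_const _
    · rw [hS i D, lintegral_pi_prod_eq_prod (fun h => sampleLaw (S.dist i D h) (Mstar h))
        (fun h s => sqrtLikRatio (M h) (Mstar h) s *
          expENN (hellGain (S.dist i D h) (M h) (Mstar h)))
        (fun h => (measurable_sqrtLikRatio _ _).mul_const _)]
      refine Finset.prod_le_one' fun h _ => ?_
      rw [lintegral_mul_const _ (measurable_sqrtLikRatio _ _)]
      exact HasSampleLaw.lintegral_mul_expENN_le
        (fun g hg => lintegral_sampleLaw (S.dist i D h) (Mstar h) hg) (PMF.tsum_coe _) (M h)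

/-- Unnormalized mixture of the data distributions. -/
def DataCollection.weights (S : DataCollection Mstar) {n : ℕ} (D : Fin n → Round X A H)
    (h : Fin H) (z : X × A) : ℝ≥0∞ := ∑ i : Fin n, S.dist i (firstElems D i i.isLt.le) h z

theorem DataCollection.weights_ne_top (S : DataCollection Mstar) {n : ℕ}
    (D : Fin n → Round X A H) (h : Fin H) (z : X × A) : S.weights D h z ≠ ∞ :=
  ENNReal.sum_ne_top.2 fun _ _ => PMF.apply_ne_top _ _

theorem two_mul_sum_hellGain {ι : Type*} (s : Finset ι) (μ : ι → X × A → ℝ≥0∞)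
    (m m' : LayerModel X A ρ) :
    2 * ∑ i ∈ s, hellGain (μ i) m m' = ∑' z, (∑ i ∈ s, μ i z) * hellSq m m' z := by
  unfold hellGain
  rw [← Summable.tsum_finsetSum fun _ _ => ENNReal.summable, ← ENNReal.tsum_mul_left]
  refine tsum_congr fun z => ?_
  rw [← Finset.sum_mul, mul_left_comm, ENNReal.mul_div_cancel (by norm_num) (by norm_num)]

theorem DataCollection.two_mul_totalGain (S : DataCollection Mstar) {n : ℕ}
    (D : Fin n → Round X A H) (h : Fin H) (m : LayerModel X A ρ) :
    2 * S.totalGain D h m = ∑' z, S.weights D h z * hellSq m (Mstar h) z :=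
  two_mul_sum_hellGain _ _ _ _

/-! ### Union bounds over the model class -/

theorem card_le_maxLayerModels (𝓜 : Fin H → Finset (LayerModel X A ρ)) (h : Fin H) :
    (𝓜 h).card ≤ maxLayerModels 𝓜 :=
  Finset.le_sup (f := fun h => (𝓜 h).card) (Finset.mem_univ h)

/-- Union bound over the layers and the models of each layer. -/
theorem measure_exists_layer_le {Ω : Type*} [MeasurableSpace Ω] (P : Measure Ω)
    (𝓜 : Fin H → Finset (LayerModel X A ρ)) (hne : ∀ h, (𝓜 h).Nonempty) (hH : 0 < H) {δ : ℝ}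
    (hδ : 0 < δ) (E : Fin H → LayerModel X A ρ → Set Ω)
    (hE : ∀ h, ∀ m ∈ 𝓜 h, P (E h m) ≤
      ENNReal.ofReal (Real.exp (-Real.log (maxLayerModels 𝓜 * H / δ)))) :
    P (⋃ h, ⋃ m ∈ 𝓜 h, E h m) ≤ ENNReal.ofReal δ := by
  have hN : 0 < maxLayerModels 𝓜 :=
    (Finset.card_pos.2 (hne ⟨0, hH⟩)).trans_le (card_le_maxLayerModels 𝓜 _)
  have hN' : (0 : ℝ) < maxLayerModels 𝓜 := by exact_mod_cast hN
  have hH' : (0 : ℝ) < H := by exact_mod_cast hH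
  have hexp : Real.exp (-Real.log (maxLayerModels 𝓜 * H / δ)) = δ / (maxLayerModels 𝓜 * H) := by
    rw [Real.exp_neg, Real.exp_log (by positivity), inv_div]
  rw [hexp] at hE
  calc P (⋃ h, ⋃ m ∈ 𝓜 h, E h m) ≤ ∑ h, P (⋃ m ∈ 𝓜 h, E h m) := measure_iUnion_fintype_le _ _
    _ ≤ ∑ h : Fin H, ∑ m ∈ 𝓜 h, P (E h m) :=
        Finset.sum_le_sum fun h _ => measure_biUnion_finset_le _ _
    _ ≤ ∑ h : Fin H, ∑ m ∈ 𝓜 h, ENNReal.ofReal (δ / (maxLayerModels 𝓜 * H)) :=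
        Finset.sum_le_sum fun h _ => Finset.sum_le_sum fun m hm => hE h m hm
    _ ≤ ∑ h : Fin H, (maxLayerModels 𝓜 : ℝ≥0∞) * ENNReal.ofReal (δ / (maxLayerModels 𝓜 * H)) := by
        refine Finset.sum_le_sum fun h _ => ?_
        rw [Finset.sum_const, nsmul_eq_mul]
        gcongr
        exact card_le_maxLayerModels 𝓜 h
    _ = ENNReal.ofReal δ := by
        rw [Finset.sum_const, nsmul_eq_mul, Finset.card_univ, Fintype.card_fin,
          ← ENNReal.ofReal_natCast, ← ENNReal.ofReal_natCast, ← ENNReal.ofReal_mul hN'.le,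
          ← ENNReal.ofReal_mul hH'.le]
        congr 1
        field_simp

theorem measure_exists_model_le {Ω : Type*} [MeasurableSpace Ω] (P : Measure Ω)
    (𝓜 : Fin H → Finset (LayerModel X A ρ)) (hne : ∀ h, (𝓜 h).Nonempty) (hH : 0 < H) {δ : ℝ}
    (hδ : 0 < δ) (E : Model X A ρ H → Set Ω)
    (hE : ∀ M ∈ modelSet 𝓜, P (E M) ≤
      ENNReal.ofReal (Real.exp (-Real.log (numModels 𝓜 * H / δ)))) :
    P (⋃ M ∈ modelSet 𝓜, E M) ≤ ENNReal.ofReal δ := by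
  classical
  have hN' : (0 : ℝ) < numModels 𝓜 := by
    exact_mod_cast Finset.prod_pos fun h _ => Finset.card_pos.2 (hne h)
  have hH' : (1 : ℝ) ≤ H := by exact_mod_cast hH
  have hexp : Real.exp (-Real.log (numModels 𝓜 * H / δ)) = δ / (numModels 𝓜 * H) := by
    rw [Real.exp_neg, Real.exp_log (by positivity), inv_div]
  rw [hexp] at hE
  have hset : modelSet 𝓜 = ↑(Fintype.piFinset 𝓜) := by
    ext M
    simp [modelSet]
  rw [hset] at hE ⊢
  calc P (⋃ M ∈ Fintype.piFinset 𝓜, E M) ≤ ∑ M ∈ Fintype.piFinset 𝓜, P (E M) :=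
        measure_biUnion_finset_le _ _
    _ ≤ ∑ M ∈ Fintype.piFinset 𝓜, ENNReal.ofReal (δ / (numModels 𝓜 * H)) :=
        Finset.sum_le_sum fun M hM => hE M hM
    _ = ENNReal.ofReal (numModels 𝓜 * (δ / (numModels 𝓜 * H))) := by
        rw [Finset.sum_const, nsmul_eq_mul, Fintype.card_piFinset, ENNReal.ofReal_mul hN'.le,
          ENNReal.ofReal_natCast]
        rfl
    _ ≤ ENNReal.ofReal δ := by
        refine ENNReal.ofReal_le_ofReal ?_
        rw [show (numModels 𝓜 : ℝ) * (δ / (numModels 𝓜 * H)) = δ / H by field_simp]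
        exact div_le_self hδ.le hH'

/-! ### CC-boundedness -/

theorem clipSum_weights_le (M : Model X A ρ H) (d₁ : PMF X) (π : Policy X A H) (h : Fin H)
    {n : ℕ} (hn : 0 < n) {γ : ℝ≥0} (hγ : 0 < γ) (w μ : X × A → ℝ≥0∞)
    (hμ : ∀ z, μ z = w z / n) :
    clipSum (occupancy M d₁ π h) w γ ≤
      ENNReal.ofReal (1 / (γ * n) * clippedConc M d₁ π h μ (γ * n)) := by
  have hn' : (0 : ℝ) < n := by exact_mod_cast hn
  have hγ' : (0 : ℝ) < γ := hγ
  set c : ℝ≥0∞ := ENNReal.ofReal (γ * n) with hc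
  have hc0 : c ≠ 0 := (ENNReal.ofReal_pos.2 (by positivity)).ne'
  have hct : c ≠ ∞ := ENNReal.ofReal_ne_top
  have hce : c = γ * n := by
    rw [hc, ENNReal.ofReal_mul hγ'.le, ENNReal.ofReal_coe_nnreal, ENNReal.ofReal_natCast]
  set T := ∑' z, occupancy M d₁ π h z * min (densRatio (occupancy M d₁ π h z) (μ z)) c with hT
  have hTt : T ≠ ∞ := by
    refine ne_top_of_le_ne_top hct ?_
    calc T ≤ ∑' z, occupancy M d₁ π h z * c :=
          ENNReal.tsum_le_tsum fun z => by gcongr; exact min_le_right _ _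
      _ = c := by rw [ENNReal.tsum_mul_right, tsum_occupancy, one_mul]
  have hcc : clippedConc M d₁ π h μ (γ * n) = T.toReal := rfl
  rw [hcc, ENNReal.ofReal_mul (by positivity), ENNReal.ofReal_toReal hTt, one_div,
    ENNReal.ofReal_inv_of_pos (by positivity), ← hc, hT, ← ENNReal.tsum_mul_left, clipSum]
  refine ENNReal.tsum_le_tsum fun z => ?_
  rcases eq_or_ne (occupancy M d₁ π h z) 0 with h0 | h0
  · simp [h0]
  rw [mul_left_comm]
  gcongr
  have : densRatio (occupancy M d₁ π h z) (μ z) = occupancy M d₁ π h z / μ z := by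
    simp [densRatio, h0]
  rw [this, hμ, (show Monotone fun x => c⁻¹ * x from fun _ _ h => mul_le_mul' le_rfl h).map_min,
    ENNReal.inv_mul_cancel hc0 hct]
  refine min_le_min (le_of_eq ?_) le_rfl
  rw [hce]
  have hn0 : (n : ℝ≥0∞) ≠ 0 := by exact_mod_cast hn.ne'
  have hγ0 : (γ : ℝ≥0∞) ≠ 0 := by exact_mod_cast hγ.ne'
  rw [div_eq_mul_inv, div_eq_mul_inv, div_eq_mul_inv,
    ENNReal.mul_inv (Or.inl hγ0) (Or.inl ENNReal.coe_ne_top),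
    ENNReal.mul_inv (Or.inl hγ0) (Or.inl ENNReal.coe_ne_top),
    ENNReal.mul_inv (Or.inr (ENNReal.inv_ne_top.2 hn0)) (Or.inr (by simp)), inv_inv]
  rw [show ((γ : ℝ≥0∞)⁻¹ * (n : ℝ≥0∞)⁻¹) * (occupancy M d₁ π h z * ((w z)⁻¹ * n)) =
    occupancy M d₁ π h z * ((γ : ℝ≥0∞)⁻¹ * (w z)⁻¹) * ((n : ℝ≥0∞)⁻¹ * n) by ring,
    ENNReal.inv_mul_cancel hn0 (by simp), mul_one]

end MDP

end

noncomputable section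

section MDP

variable {X A : Type*} [MeasurableSpace X] [MeasurableSpace A] {ρ : Measure ℝ}
variable [Countable X] [DiscreteMeasurableSpace X] [Countable A] [DiscreteMeasurableSpace A]
variable {H : ℕ} {Mstar : Model X A ρ H}

theorem clippedConc_nonneg (M : Model X A ρ H) (d₁ : PMF X) (π : Policy X A H) (h : Fin H)
    (μ : X × A → ℝ≥0∞) (γ : ℝ) : 0 ≤ clippedConc M d₁ π h μ γ := ENNReal.toReal_nonneg

theorem expReward_sub_le_of_totalGain_le (S : DataCollection Mstar) {n : ℕ} (hn : 0 < n)
    (D : Fin n → Round X A H) {M : Model X A ρ H} (hM : NormalizedRewards M)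
    (hMstar : NormalizedRewards Mstar) {π : DetPolicy X A H} (hπ : IsOptimalFor M π) (d₁ : PMF X)
    (π' : Policy X A H) {L : ℝ} (hL0 : 0 ≤ L)
    (hL : ∑ h, S.totalGain D h (M h) ≤ ENNReal.ofReal L) {γ : ℝ} (hγ : 0 < γ) :
    expReward Mstar d₁ π' - expReward Mstar d₁ π.toPolicy ≤
      (∑ h : Fin H, 6 / γ / n * (clippedConc Mstar d₁ π' h (S.mixture D h) (γ * n) +
        clippedConc Mstar d₁ π.toPolicy h (S.mixture D h) (γ * n))) + 8 * L * γ := by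
  lift γ to ℝ≥0 using hγ.le
  have hγ' : 0 < γ := hγ
  have hn' : (0 : ℝ) < n := by exact_mod_cast hn
  have key := ofReal_expReward_sub_le_clipSum hM hMstar hπ d₁ π'
    (w := fun h => S.weights D h) (fun h z => S.weights_ne_top D h z) hγ'
  have hcl : ∀ (π : Policy X A H) (h : Fin H),
      clipSum (occupancy Mstar d₁ π h) (S.weights D h) γ ≤
        ENNReal.ofReal (1 / (γ * n) * clippedConc Mstar d₁ π h (S.mixture D h) (γ * n)) :=
    fun π h => clipSum_weights_le Mstar d₁ π h hn hγ' _ _ fun z => rfl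
  have hnn : ∀ (π : Policy X A H) (h : Fin H),
      0 ≤ 1 / (γ * n) * clippedConc Mstar d₁ π h (S.mixture D h) (γ * n) := fun π h =>
    mul_nonneg (by positivity) (clippedConc_nonneg _ _ _ _ _ _)
  have hbound : ENNReal.ofReal (expReward Mstar d₁ π' - expReward Mstar d₁ π.toPolicy) ≤
      ENNReal.ofReal ((∑ h : Fin H, 4 * (1 / (γ * n) *
        clippedConc Mstar d₁ π' h (S.mixture D h) (γ * n) +
        1 / (γ * n) * clippedConc Mstar d₁ π.toPolicy h (S.mixture D h) (γ * n))) +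
          4 * γ * L) := by
    refine key.trans ?_
    rw [Finset.sum_add_distrib, ENNReal.ofReal_add
      (Finset.sum_nonneg fun h _ => mul_nonneg (by norm_num) (add_nonneg (hnn _ _) (hnn _ _)))
      (by positivity)]
    refine add_le_add ?_ ?_
    · rw [ENNReal.ofReal_sum_of_nonneg fun h _ =>
        mul_nonneg (by norm_num) (add_nonneg (hnn _ _) (hnn _ _))]
      refine Finset.sum_le_sum fun h _ => ?_
      rw [ENNReal.ofReal_mul (by norm_num), ENNReal.ofReal_add (hnn _ _) (hnn _ _)]
      refine mul_le_mul' (by simp) (add_le_add (hcl _ _) (hcl _ _))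
    · simp_rw [← S.two_mul_totalGain, ← mul_assoc, ← Finset.mul_sum]
      rw [ENNReal.ofReal_mul (by positivity), ENNReal.ofReal_mul (by norm_num),
        ENNReal.ofReal_coe_nnreal]
      refine mul_le_mul' (le_of_eq ?_) hL
      rw [mul_right_comm]
      norm_num
  have hreal := (ENNReal.ofReal_le_ofReal_iff (add_nonneg (Finset.sum_nonneg fun h _ =>
    mul_nonneg (by norm_num) (add_nonneg (hnn _ _) (hnn _ _))) (by positivity))).1 hbound
  refine hreal.trans (add_le_add (Finset.sum_le_sum fun h _ => ?_) ?_)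
  · rw [← mul_add, ← mul_assoc]
    refine mul_le_mul_of_nonneg_right ?_
      (add_nonneg (clippedConc_nonneg _ _ _ _ _ _) (clippedConc_nonneg _ _ _ _ _ _))
    rw [div_div, ← mul_div_assoc, mul_one]
    gcongr
    norm_num
  · nlinarith [mul_nonneg hL0 hγ.le]

variable {𝓜 : Fin H → Finset (LayerModel X A ρ)} {optPol : Model X A ρ H → DetPolicy X A H}
  {πstar : DetPolicy X A H} {est : (n : ℕ) → (Fin n → Round X A H) → Model X A ρ H} {δ : ℝ}

theorem log_numModels_nonneg (hH : 0 < H) (hδ : 0 < δ) (hδ1 : δ < 1)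
    (hMstar : Mstar ∈ modelSet 𝓜) : 0 ≤ Real.log (numModels 𝓜 * H / δ) := by
  have hN : (1 : ℝ) ≤ numModels 𝓜 := by
    exact_mod_cast Finset.prod_pos fun h _ => Finset.card_pos.2 ⟨_, hMstar h⟩
  have hH' : (1 : ℝ) ≤ H := by exact_mod_cast hH
  refine Real.log_nonneg ((one_le_div hδ).2 ?_)
  nlinarith

theorem one_le_maxLayerModels (hH : 0 < H) (hMstar : Mstar ∈ modelSet 𝓜) :
    1 ≤ maxLayerModels 𝓜 :=
  (Finset.card_pos.2 ⟨_, hMstar ⟨0, hH⟩⟩).trans_le (card_le_maxLayerModels 𝓜 _)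

theorem log_maxLayerModels_nonneg (hH : 0 < H) (hδ : 0 < δ) (hδ1 : δ < 1)
    (hMstar : Mstar ∈ modelSet 𝓜) : 0 ≤ Real.log (maxLayerModels 𝓜 * H / δ) := by
  have hN : (1 : ℝ) ≤ maxLayerModels 𝓜 := by exact_mod_cast one_le_maxLayerModels hH hMstar
  have hH' : (1 : ℝ) ≤ H := by exact_mod_cast hH
  refine Real.log_nonneg ((one_le_div hδ).2 ?_)
  nlinarith

theorem ccBounded_mleAlg_of_layerIndependent (d₁ : PMF X) (hH : 0 < H)
    (hnorm : ∀ M ∈ modelSet 𝓜, NormalizedRewards M)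
    (hopt : ∀ M ∈ modelSet 𝓜, IsOptimalFor M (optPol M)) (hest : IsMLERule 𝓜 est)
    (hδ : 0 < δ) (hδ1 : δ < 1) (hMstar : Mstar ∈ modelSet 𝓜) :
    CCBounded (mleAlg est optPol) Mstar d₁ πstar (fun S => S.LayerIndependent) δ
      (fun γ => 6 / γ) (fun γ => 8 * Real.log (numModels 𝓜 * H / δ) * γ) := by
  intro S hS n hn
  have hL0 := log_numModels_nonneg hH hδ hδ1 hMstar
  refine (measure_mono fun D hD => ?_).trans (measure_exists_model_le (S.datasetLaw n) 𝓜
    (fun h => ⟨_, hMstar h⟩) hH hδ _ fun M _ => hS.measure_le n M _)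
  by_contra hcon
  refine hD fun γ hγ => ?_
  have hMhat : est n D ∈ modelSet 𝓜 := fun h => (hest.1 n D h).1
  refine expReward_sub_le_of_totalGain_le S hn D (hnorm _ hMhat) (hnorm _ hMstar)
    (hopt _ hMhat) d₁ _ hL0 ?_ hγ
  by_contra hlt
  exact hcon (Set.mem_biUnion hMhat
    ⟨fun h => (hest.1 n D).prod_sampleDens_le (hMstar h), not_le.1 hlt⟩)

theorem ccBounded_mleAlg (d₁ : PMF X) (hH : 0 < H)
    (hnorm : ∀ M ∈ modelSet 𝓜, NormalizedRewards M)
    (hopt : ∀ M ∈ modelSet 𝓜, IsOptimalFor M (optPol M)) (hest : IsMLERule 𝓜 est)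
    (hδ : 0 < δ) (hδ1 : δ < 1) (hMstar : Mstar ∈ modelSet 𝓜) :
    CCBounded (mleAlg est optPol) Mstar d₁ πstar (fun _ => True) δ
      (fun γ => 6 / γ) (fun γ => H * (8 * Real.log (maxLayerModels 𝓜 * H / δ) * γ)) := by
  intro S _ n hn
  have hL0 := log_maxLayerModels_nonneg hH hδ hδ1 hMstar
  refine (measure_mono fun D hD => ?_).trans (measure_exists_layer_le (S.datasetLaw n) 𝓜
    (fun h => ⟨_, hMstar h⟩) hH hδ _ fun h m _ => S.measure_layer_le n h m _)
  by_contra hcon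
  refine hD fun γ hγ => ?_
  have hMhat : est n D ∈ modelSet 𝓜 := fun h => (hest.1 n D h).1
  have := expReward_sub_le_of_totalGain_le S hn D (hnorm _ hMhat) (hnorm _ hMstar)
    (hopt _ hMhat) d₁ πstar.toPolicy (mul_nonneg (Nat.cast_nonneg H) hL0) ?_ hγ
  · refine this.trans (le_of_eq ?_)
    simp only [mleAlg]
    ring
  · calc ∑ h, S.totalGain D h (est n D h)
        ≤ ∑ _h : Fin H, ENNReal.ofReal (Real.log (maxLayerModels 𝓜 * H / δ)) := by
          refine Finset.sum_le_sum fun h _ => ?_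
          by_contra hlt
          exact hcon (Set.mem_iUnion.2 ⟨h, Set.mem_biUnion (hMhat h)
            ⟨(hest.1 n D).prod_sampleDens_le (hMstar h), not_le.1 hlt⟩⟩)
      _ = _ := by
          rw [Finset.sum_const, nsmul_eq_mul, Finset.card_univ, Fintype.card_fin,
            ENNReal.ofReal_mul (Nat.cast_nonneg _), ENNReal.ofReal_natCast]

end MDP

end

noncomputable section

/-! ### Potential argument -/

/-- Elliptic-potential bound for clipped self-normalized sums of bounded terms. -/
theorem sum_le_min_add_log {a f : ℕ → ℝ} {b γ : ℝ} (hb : 0 < b) (hγ : 0 < γ)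
    (ha0 : ∀ s, 0 ≤ a s) (hab : ∀ s, a s ≤ b) (hfa : ∀ s, f s ≤ a s)
    (hf : ∀ s, 0 < ∑ r ∈ Finset.range s, a r →
      f s ≤ a s * (a s / (γ * ∑ r ∈ Finset.range s, a r))) (n : ℕ) :
    ∑ s ∈ Finset.range n, f s ≤ min (∑ s ∈ Finset.range n, a s) (2 * b) +
      2 * b / γ * Real.log (max ((∑ s ∈ Finset.range n, a s) / b) 1) := by
  induction n with
  | zero => simp [hb.le]
  | succ n ih =>
    rw [Finset.sum_range_succ, Finset.sum_range_succ (f := a)]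
    set W := ∑ s ∈ Finset.range n, a s with hW
    have hW0 : 0 ≤ W := Finset.sum_nonneg fun s _ => ha0 s
    have hlog : Real.log (max (W / b) 1) ≤ Real.log (max ((W + a n) / b) 1) := by
      refine Real.log_le_log (by positivity) (max_le_max ?_ le_rfl)
      gcongr
      linarith [ha0 n]
    have hc : 0 ≤ 2 * b / γ := by positivity
    rcases lt_or_ge W b with h | h
    · have h1 : min (W + a n) (2 * b) = W + a n := min_eq_left (by linarith [hab n])
      have h2 : min W (2 * b) = W := min_eq_left (by linarith)
      rw [h1]
      rw [h2] at ih
      have := mul_le_mul_of_nonneg_left hlog hc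
      linarith [hfa n]
    · have hWpos : 0 < W := hb.trans_le h
      have hmin : min W (2 * b) ≤ min (W + a n) (2 * b) :=
        min_le_min (by linarith [ha0 n]) le_rfl
      have e1 : max (W / b) 1 = W / b := max_eq_left ((one_le_div hb).2 h)
      have e2 : max ((W + a n) / b) 1 = (W + a n) / b :=
        max_eq_left ((one_le_div hb).2 (by linarith [ha0 n]))
      rw [e2]
      rw [e1] at ih
      have hdiff : Real.log ((W + a n) / b) - Real.log (W / b) = Real.log (1 + a n / W) := by
        have hpos : 0 < W + a n := by linarith [ha0 n]
        rw [← Real.log_div (by positivity) (by positivity)]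
        congr 1
        field_simp
      have hx0 : 0 ≤ a n / W := div_nonneg (ha0 n) hWpos.le
      have hx1 : a n / W ≤ 1 := (div_le_one hWpos).2 ((hab n).trans h)
      have hlog2 : a n / W ≤ 2 * Real.log (1 + a n / W) := by
        have h3 := Real.one_sub_inv_le_log_of_pos (show 0 < 1 + a n / W by linarith)
        have h4 : a n / W / 2 ≤ 1 - (1 + a n / W)⁻¹ := by
          have hne : 1 + a n / W ≠ 0 := by positivity
          rw [show 1 - (1 + a n / W)⁻¹ = (a n / W) / (1 + a n / W) by
            rw [eq_div_iff hne, sub_mul, inv_mul_cancel₀ hne]; ring]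
          gcongr
          linarith
        linarith
      have hterm : f n ≤ 2 * b / γ * Real.log (1 + a n / W) := by
        calc f n ≤ a n * (a n / (γ * W)) := hf n hWpos
          _ ≤ b * (a n / (γ * W)) := by
            gcongr
            · exact div_nonneg (ha0 n) (by positivity)
            · exact hab n
          _ = b / γ * (a n / W) := by field_simp
          _ ≤ b / γ * (2 * Real.log (1 + a n / W)) := by gcongr
          _ = _ := by ring
      have : 2 * b / γ * Real.log ((W + a n) / b) = 2 * b / γ * Real.log (W / b) +
          2 * b / γ * Real.log (1 + a n / W) := by rw [← hdiff]; ring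
      linarith

theorem sum_clip_le {a : ℕ → ℝ≥0∞} {b γ : ℝ≥0} (hγ : 0 < γ) (hab : ∀ s, a s ≤ b) {n : ℕ}
    (hn : 0 < n) :
    ∑ s ∈ Finset.range n, a s * min (a s / (γ * ∑ r ∈ Finset.range s, a r)) 1 ≤
      b * ENNReal.ofReal (2 + 2 / γ * Real.log n) := by
  have hat : ∀ s, a s ≠ ∞ := fun s => ((hab s).trans_lt ENNReal.coe_lt_top).ne
  lift a to ℕ → ℝ≥0 using hat
  have hab' : ∀ s, a s ≤ b := fun s => ENNReal.coe_le_coe.1 (hab s)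
  have hγ0 : (0 : ℝ) < γ := hγ
  rcases eq_or_lt_of_le (zero_le : 0 ≤ b) with rfl | hb
  · have : ∀ s, a s = 0 := fun s => le_antisymm (hab' s) zero_le
    simp [this]
  have hft : ∀ s, (a s : ℝ≥0∞) * min (a s / (γ * ∑ r ∈ Finset.range s, (a r : ℝ≥0∞))) 1 ≤ a s :=
    fun s => mul_le_of_le_one_right' (min_le_right _ _)
  have hfne : ∀ s, (a s : ℝ≥0∞) * min (a s / (γ * ∑ r ∈ Finset.range s, (a r : ℝ≥0∞))) 1 ≠ ∞ :=
    fun s => ((hft s).trans_lt ENNReal.coe_lt_top).ne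
  have hb' : (0 : ℝ) < b := hb
  have key := sum_le_min_add_log (a := fun s => (a s : ℝ)) (b := b) (γ := γ)
    (f := fun s => ((a s : ℝ≥0∞) *
      min (a s / (γ * ∑ r ∈ Finset.range s, (a r : ℝ≥0∞))) 1).toReal) hb' hγ0
    (fun s => (a s).coe_nonneg) (fun s => hab' s)
    (fun s => ENNReal.toReal_mono ENNReal.coe_ne_top (hft s)) (fun s hs => ?_) n
  · rw [← ENNReal.toReal_sum fun s _ => hfne s] at key
    have hlog : Real.log (max ((∑ s ∈ Finset.range n, (a s : ℝ)) / b) 1) ≤ Real.log n := by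
      refine Real.log_le_log (by positivity) (max_le ?_ (by exact_mod_cast hn))
      rw [div_le_iff₀ hb']
      calc ∑ s ∈ Finset.range n, (a s : ℝ) ≤ ∑ s ∈ Finset.range n, (b : ℝ) :=
            Finset.sum_le_sum fun s _ => hab' s
        _ = n * b := by simp
    have h2 := mul_le_mul_of_nonneg_left hlog (show 0 ≤ 2 * (b : ℝ) / γ by positivity)
    rw [← ENNReal.ofReal_toReal (ENNReal.sum_ne_top.2 fun s _ => hfne s),
      ← ENNReal.ofReal_coe_nnreal (p := b), ← ENNReal.ofReal_mul b.coe_nonneg]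
    refine ENNReal.ofReal_le_ofReal (key.trans ?_)
    have h3 := min_le_right (∑ s ∈ Finset.range n, (a s : ℝ)) (2 * (b : ℝ))
    have h4 : (b : ℝ) * (2 + 2 / γ * Real.log n) = 2 * b + 2 * b / γ * Real.log n := by ring
    linarith
  · have hs' : 0 < ∑ r ∈ Finset.range s, a r := by
      rw [← NNReal.coe_pos]; push_cast; exact hs
    have e : ((a s : ℝ≥0∞) * (a s / (γ * ∑ r ∈ Finset.range s, (a r : ℝ≥0∞)))) =
        ((a s * (a s / (γ * ∑ r ∈ Finset.range s, a r)) : ℝ≥0) : ℝ≥0∞) := by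
      rw [ENNReal.coe_mul, ENNReal.coe_div (by positivity)]
      push_cast
      rfl
    calc _ ≤ ((a s : ℝ≥0∞) * (a s / (γ * ∑ r ∈ Finset.range s, (a r : ℝ≥0∞)))).toReal := by
          refine ENNReal.toReal_mono ?_ (by gcongr; exact min_le_left _ _)
          rw [e]; exact ENNReal.coe_ne_top
      _ = _ := by
          rw [e, ENNReal.coe_toReal]
          push_cast
          rfl

section MDP

variable {X A : Type*} [MeasurableSpace X] [MeasurableSpace A] {ρ : Measure ℝ}

theorem le_mul_of_densRatio_le {p q : ℝ≥0∞} {C : ℝ≥0} (hqt : q ≠ ∞) (h : densRatio p q ≤ C) : p ≤ C * q := by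
  unfold densRatio at h
  split_ifs at h with h0
  · simp [h0.1]
  · rcases eq_or_ne q 0 with rfl | hq
    · have hp : p ≠ 0 := fun hp => h0 ⟨hp, rfl⟩
      rw [ENNReal.div_zero hp] at h
      simp at h
    · exact (ENNReal.div_le_iff hq hqt).1 h

theorem sum_clipSum_le_of_coverage (d : ℕ → X × A → ℝ≥0∞) (w : ℕ → X × A → ℝ≥0∞)
    (μ : PMF (X × A)) {C γ : ℝ≥0} (hγ : 0 < γ) (hd : ∀ t z, d t z ≤ C * μ z)
    (hw : ∀ t z, ∑ s ∈ Finset.range t, d s z ≤ w t z) {T : ℕ} (hT : 0 < T) :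
    ∑ t ∈ Finset.range T, clipSum (d t) (w t) γ ≤ C * ENNReal.ofReal (2 + 2 / γ * Real.log T) := by
  unfold clipSum
  rw [← Summable.tsum_finsetSum fun _ _ => ENNReal.summable]
  calc ∑' z, ∑ t ∈ Finset.range T, d t z * min (d t z / (γ * w t z)) 1
      ≤ ∑' z, (C * μ z) * ENNReal.ofReal (2 + 2 / γ * Real.log T) := by
        refine ENNReal.tsum_le_tsum fun z => ?_
        have e : (C : ℝ≥0∞) * μ z = ((C * (μ z).toNNReal : ℝ≥0) : ℝ≥0∞) := by
          rw [ENNReal.coe_mul, ENNReal.coe_toNNReal (PMF.apply_ne_top _ _)]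
        rw [e]
        refine le_trans (Finset.sum_le_sum fun t _ => ?_)
          (sum_clip_le hγ (a := fun t => d t z) (fun t => (hd t z).trans e.le) hT)
        gcongr
        exact hw t z
    _ = _ := by rw [ENNReal.tsum_mul_right, ENNReal.tsum_mul_left, PMF.tsum_coe, mul_one]

theorem sum_clipSum_le_of_offline {d : X × A → ℝ≥0∞} (hd1 : ∑' z, d z = 1)
    (w : ℕ → X × A → ℝ≥0∞) (ν : PMF (X × A)) {C γ : ℝ≥0} (hγ : 0 < γ) (hd : ∀ z, d z ≤ C * ν z)
    (hw : ∀ (t : ℕ) z, (t : ℝ≥0∞) * ν z ≤ w t z) {T : ℕ} (hT : 0 < T) :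
    ∑ t ∈ Finset.range T, clipSum d (w t) γ ≤
      ENNReal.ofReal (1 + C / γ * (1 + Real.log T)) := by
  have h0 : clipSum d (w 0) γ ≤ 1 := by
    rw [← hd1]
    exact ENNReal.tsum_le_tsum fun z => mul_le_of_le_one_right' (min_le_right _ _)
  have hstep : ∀ t : ℕ, clipSum d (w (t + 1)) γ ≤
      ENNReal.ofReal (C / γ * (((t : ℝ) + 1)⁻¹)) := by
    intro t
    have e : ENNReal.ofReal (C / γ * (((t : ℝ) + 1)⁻¹)) =
        ((C / γ * ((t : ℝ≥0) + 1)⁻¹ : ℝ≥0) : ℝ≥0∞) := by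
      rw [← ENNReal.ofReal_coe_nnreal]
      push_cast
      rfl
    rw [e]
    calc clipSum d (w (t + 1)) γ ≤
        ∑' z, d z * ((C / γ * ((t : ℝ≥0) + 1)⁻¹ : ℝ≥0) : ℝ≥0∞) := by
          refine ENNReal.tsum_le_tsum fun z => ?_
          gcongr
          refine (min_le_left _ _).trans (ENNReal.div_le_of_le_mul ?_)
          calc d z ≤ C * ν z := hd z
            _ = ((C / γ * ((t : ℝ≥0) + 1)⁻¹ : ℝ≥0) : ℝ≥0∞) * (γ * (((t + 1 : ℕ) : ℝ≥0∞) * ν z)) := by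
              have : C = (C / γ * ((t : ℝ≥0) + 1)⁻¹) * (γ * ((t : ℝ≥0) + 1)) := by field_simp
              conv_lhs => rw [this]
              push_cast
              ring
            _ ≤ _ := by gcongr; exact hw (t + 1) z
      _ = _ := by rw [ENNReal.tsum_mul_right, hd1, one_mul]
  obtain ⟨n, rfl⟩ : ∃ n, T = n + 1 := ⟨T - 1, by omega⟩
  rw [Finset.sum_range_succ', add_comm, ENNReal.ofReal_add zero_le_one
    (mul_nonneg (by positivity) (by have := Real.log_natCast_nonneg (n + 1); linarith)),
    ENNReal.ofReal_one]
  refine add_le_add h0 ((Finset.sum_le_sum fun t _ => hstep t).trans ?_)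
  rw [← ENNReal.ofReal_sum_of_nonneg fun t _ => by positivity, ← Finset.mul_sum]
  refine ENNReal.ofReal_le_ofReal ?_
  gcongr
  have h1 := harmonic_le_one_add_log n
  have h2 : ((harmonic n : ℚ) : ℝ) = ∑ t ∈ Finset.range n, ((t : ℝ) + 1)⁻¹ := by
    simp [harmonic]
  rw [h2] at h1
  refine h1.trans ?_
  rcases Nat.eq_zero_or_pos n with rfl | hn
  · simp
  · gcongr
    simp

variable [Countable X] [DiscreteMeasurableSpace X] [Countable A] [DiscreteMeasurableSpace A]
variable {H : ℕ} {Mstar : Model X A ρ H}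

/-- Total suboptimality of a sequence of policies, each optimal for a model that is accurate on
offline data and on the data of its predecessors. -/
theorem sum_ofReal_gap_le (hMstar : NormalizedRewards Mstar) (d₁ : PMF X)
    {πstar : Policy X A H} {M : ℕ → Model X A ρ H} (hM : ∀ t, NormalizedRewards (M t))
    {π : ℕ → DetPolicy X A H} (hπ : ∀ t, IsOptimalFor (M t) (π t))
    (ν μ : Fin H → PMF (X × A)) {Cs Cc γ : ℝ≥0} (hγ : 0 < γ)
    (hν : ∀ h z, occupancy Mstar d₁ πstar h z ≤ Cs * ν h z)
    (hμ : ∀ t h z, occupancy Mstar d₁ (π t).toPolicy h z ≤ Cc * μ h z) {T : ℕ} (hT : 0 < T)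
    {L : ℝ} (hL0 : 0 ≤ L)
    (hL : ∀ t < T, ∀ h, ∑' z, ((t : ℝ≥0∞) * ν h z + ∑ s ∈ Finset.range t,
      occupancy Mstar d₁ (π s).toPolicy h z) * hellSq (M t h) (Mstar h) z ≤
        2 * ENNReal.ofReal L) :
    ∑ t ∈ Finset.range T,
      ENNReal.ofReal (expReward Mstar d₁ πstar - expReward Mstar d₁ (π t).toPolicy) ≤
      ENNReal.ofReal (H * (4 * ((1 + Cs / γ * (1 + Real.log T)) +
        Cc * (2 + 2 / γ * Real.log T)) + 4 * γ * T * L)) := by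
  set w : ℕ → Fin H → X × A → ℝ≥0∞ := fun t h z => (t : ℝ≥0∞) * ν h z +
    ∑ s ∈ Finset.range t, occupancy Mstar d₁ (π s).toPolicy h z with hw
  have hwt : ∀ t h z, w t h z ≠ ∞ := fun t h z => ENNReal.add_ne_top.2
    ⟨ENNReal.mul_ne_top (by simp) (PMF.apply_ne_top _ _),
      ENNReal.sum_ne_top.2 fun s _ => occupancy_ne_top _ _ _ _ _⟩
  have hlogT : 0 ≤ Real.log T := Real.log_natCast_nonneg T
  have n1 : 0 ≤ 1 + (Cs : ℝ) / γ * (1 + Real.log T) := by positivity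
  have n2 : 0 ≤ 2 + 2 / (γ : ℝ) * Real.log T := by positivity
  have n3 : 0 ≤ (Cc : ℝ) * (2 + 2 / γ * Real.log T) := by positivity
  calc _ ≤ ∑ t ∈ Finset.range T, ∑ h : Fin H,
        (4 * (clipSum (occupancy Mstar d₁ πstar h) (w t h) γ +
          clipSum (occupancy Mstar d₁ (π t).toPolicy h) (w t h) γ) +
          2 * γ * (2 * ENNReal.ofReal L)) := by
        refine Finset.sum_le_sum fun t ht => (ofReal_expReward_sub_le_clipSum (hM t) hMstar (hπ t)
          d₁ πstar (hwt t) hγ).trans (Finset.sum_le_sum fun h _ => ?_)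
        gcongr
        exact hL t (Finset.mem_range.1 ht) h
    _ = ∑ h : Fin H, (4 * (∑ t ∈ Finset.range T, clipSum (occupancy Mstar d₁ πstar h) (w t h) γ +
          ∑ t ∈ Finset.range T, clipSum (occupancy Mstar d₁ (π t).toPolicy h) (w t h) γ) +
          T * (2 * γ * (2 * ENNReal.ofReal L))) := by
        rw [Finset.sum_comm]
        refine Finset.sum_congr rfl fun h _ => ?_
        rw [Finset.sum_add_distrib, ← Finset.mul_sum, Finset.sum_add_distrib, Finset.sum_const,
          Finset.card_range, nsmul_eq_mul]
    _ ≤ ∑ h : Fin H, ENNReal.ofReal (4 * ((1 + Cs / γ * (1 + Real.log T)) +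
        Cc * (2 + 2 / γ * Real.log T)) + 4 * γ * T * L) := by
        refine Finset.sum_le_sum fun h _ => ?_
        have h1 := sum_clipSum_le_of_offline (tsum_occupancy Mstar d₁ πstar h)
          (fun t => w t h) (ν h) hγ (hν h) (fun t z => le_self_add) hT
        have h2 := sum_clipSum_le_of_coverage
          (fun t => occupancy Mstar d₁ (π t).toPolicy h) (fun t => w t h) (μ h) hγ
          (fun t z => hμ t h z) (fun t z => le_add_self) hT
        rw [ENNReal.ofReal_add (by positivity) (by positivity), ENNReal.ofReal_mul (by norm_num),
          ENNReal.ofReal_add n1 n3, ENNReal.ofReal_mul Cc.coe_nonneg, ENNReal.ofReal_coe_nnreal]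
        refine add_le_add (mul_le_mul' (by simp) (add_le_add h1 h2)) (le_of_eq ?_)
        rw [ENNReal.ofReal_mul (by positivity), ENNReal.ofReal_mul (by positivity),
          ENNReal.ofReal_mul (by norm_num), ENNReal.ofReal_natCast, ENNReal.ofReal_coe_nnreal,
          ENNReal.ofReal_ofNat, show (4 : ℝ≥0∞) = 2 * 2 by norm_num]
        ring
    _ = _ := by
        rw [Finset.sum_const, nsmul_eq_mul, Finset.card_univ, Fintype.card_fin,
          ENNReal.ofReal_mul (Nat.cast_nonneg _), ENNReal.ofReal_natCast]

end MDP

end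

noncomputable section

/-! ### Initial segments of the data -/

@[to_additive]
theorem prod_castLE_eq {M : Type*} [CommMonoid M] {T t : ℕ} (ht : t ≤ T) (f : Fin T → M) :
    ∏ i : Fin t, f (Fin.castLE ht i) = ∏ i : Fin T, if (i : ℕ) < t then f i else 1 := by
  obtain ⟨k, rfl⟩ := Nat.exists_eq_add_of_le ht
  rw [Fin.prod_univ_add]
  simp only [Fin.val_castAdd, Fin.is_lt, if_true, Fin.val_natAdd, add_lt_iff_neg_left, not_lt_zero,
    if_false, Finset.prod_const_one, mul_one]
  rfl

theorem lintegral_iterLaw_prod_castLE_le_one {E : Type*} [MeasurableSpace E]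
    (κ : (i : ℕ) → (Fin i → E) → Measure E) (g : (i : ℕ) → (Fin i → E) → E → ℝ≥0∞) {n t : ℕ}
    (ht : t ≤ n) (hκ : ∀ i < n, ∀ D, κ i D Set.univ ≤ 1)
    (hg : ∀ i < t, ∀ D, Measurable (g i D))
    (h1 : ∀ i < t, ∀ D, ∫⁻ e, g i D e ∂(κ i D) ≤ 1) :
    ∫⁻ D, ∏ i : Fin t, g i (firstElems D i (i.isLt.le.trans ht)) (D (Fin.castLE ht i))
      ∂(iterLaw κ n) ≤ 1 := by
  refine le_trans (le_of_eq (lintegral_congr fun D => ?_)) (lintegral_iterLaw_prod_le_one κ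
    (fun i D e => if i < t then g i D e else 1) n (fun i _ D => ?_) (fun i hi D => ?_))
  · exact prod_castLE_eq ht fun i => g i (firstElems D i i.isLt.le) (D i)
  · by_cases hit : i < t
    · simpa [hit] using hg i hit D
    · simp [hit]
  · by_cases hit : i < t
    · simpa [hit] using h1 i hit D
    · simpa [hit] using hκ i hi D

theorem lintegral_pi_prod_castLE_le_one {E : Type*} [MeasurableSpace E] (q : Measure E)
    [IsProbabilityMeasure q] {g : E → ℝ≥0∞} (hg : Measurable g) (h1 : ∫⁻ e, g e ∂q ≤ 1) {n t : ℕ}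
    (ht : t ≤ n) :
    ∫⁻ D, ∏ i : Fin t, g (D (Fin.castLE ht i)) ∂(Measure.pi fun _ : Fin n => q) ≤ 1 := by
  have e := lintegral_pi_prod_eq_prod (fun _ : Fin n => q)
    (fun i e => if (i : ℕ) < t then g e else 1) (fun i => by
      by_cases hit : (i : ℕ) < t
      · simpa [hit] using hg
      · simp [hit])
  refine le_trans (le_of_eq ((lintegral_congr fun D : Fin n → E =>
    prod_castLE_eq ht fun i => g (D i)).trans e)) (Finset.prod_le_one' fun i _ => ?_)
  by_cases hit : (i : ℕ) < t
  · simpa [hit] using h1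
  · simp [hit]

theorem measurable_finAppend {E : Type*} [MeasurableSpace E] {m n : ℕ} :
    Measurable fun p : (Fin m → E) × (Fin n → E) => Fin.append p.1 p.2 := by
  refine measurable_pi_iff.2 fun i => ?_
  refine Fin.addCases (fun j => ?_) (fun j => ?_) i
  · simp only [Fin.append_left]
    exact (measurable_pi_apply j).comp measurable_fst
  · simp only [Fin.append_right]
    exact (measurable_pi_apply j).comp measurable_snd

section MDP

variable {X A : Type*} [MeasurableSpace X] [MeasurableSpace A] {ρ : Measure ℝ}
variable [Countable X] [DiscreteMeasurableSpace X] [Countable A] [DiscreteMeasurableSpace A]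
variable {H : ℕ} {Mstar : Model X A ρ H}

/-! ### The data of H₂O -/

/-- The dataset on which H₂O calls the offline algorithm after `t` iterations. -/
def h2oData {T : ℕ} (ω : (Fin T → Round X A H) × (Fin T → Round X A H)) {t : ℕ} (ht : t ≤ T) :
    Fin (t + t) → Round X A H :=
  Fin.append (firstElems ω.1 t ht) (firstElems ω.2 t ht)

theorem measurable_h2oData {T t : ℕ} (ht : t ≤ T) :
    Measurable fun ω : (Fin T → Round X A H) × (Fin T → Round X A H) => h2oData ω ht :=
  measurable_finAppend.comp (((measurable_firstElems t ht).comp measurable_fst).prodMk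
    ((measurable_firstElems t ht).comp measurable_snd))

theorem prod_sampleDens_h2oData {T t : ℕ} (ht : t ≤ T)
    (ω : (Fin T → Round X A H) × (Fin T → Round X A H)) (h : Fin H) (m : LayerModel X A ρ) :
    ∏ i, m.sampleDens (h2oData ω ht i h) = ∏ j : Fin t ⊕ Fin t,
      m.sampleDens (Sum.elim (fun i => ω.1 (Fin.castLE ht i) h)
        (fun i => ω.2 (Fin.castLE ht i) h) j) := by
  rw [Fin.prod_univ_add, Fintype.prod_sum_type]
  simp only [h2oData, Fin.append_left, Fin.append_right]
  rfl

/-- The kernel that generates the online data of H₂O. -/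
def h2oKernel (alg : OfflineAlg X A H) (Mstar : Model X A ρ H) (d₁ : PMF X) {T : ℕ}
    (Doff : Fin T → Round X A H) (t : ℕ) (Don : Fin t → Round X A H) : Measure (Round X A H) :=
  if ht : t ≤ T then trajLaw Mstar d₁ (h2oPolicy alg Doff ht Don) else 0

theorem h2oKernel_of_le (alg : OfflineAlg X A H) (Mstar : Model X A ρ H) (d₁ : PMF X) {T : ℕ}
    (Doff : Fin T → Round X A H) {t : ℕ} (ht : t ≤ T) (Don : Fin t → Round X A H) :
    h2oKernel alg Mstar d₁ Doff t Don = trajLaw Mstar d₁ (h2oPolicy alg Doff ht Don) :=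
  dif_pos ht

theorem lintegral_h2oLaw_le (alg : OfflineAlg X A H) (Mstar : Model X A ρ H) (d₁ : PMF X)
    (q : Measure (Round X A H)) (T : ℕ)
    (f : (Fin T → Round X A H) × (Fin T → Round X A H) → ℝ≥0∞) :
    ∫⁻ ω, f ω ∂(h2oLaw alg Mstar d₁ q T) ≤
      ∫⁻ Doff, ∫⁻ Don, f (Doff, Don) ∂(iterLaw (h2oKernel alg Mstar d₁ Doff) T)
        ∂(Measure.pi fun _ : Fin T => q) :=
  (Measure.lintegral_bind_le _ _ _).trans (lintegral_mono fun _ => lintegral_map_le _ _)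

variable {alg : OfflineAlg X A H} {d₁ : PMF X} {q : Measure (Round X A H)}
  [IsProbabilityMeasure q] {ν : Fin H → PMF (X × A)}

theorem lintegral_h2oLaw_vanishing
    (hq : ∀ h, q.map (fun s => s h) = sampleLaw (ν h) (Mstar h)) (T : ℕ) (h : Fin H) :
    ∫⁻ ω, (∑ i, (Mstar h).vanishing (ω.1 i h) + ∑ i, (Mstar h).vanishing (ω.2 i h))
      ∂(h2oLaw alg Mstar d₁ q T) = 0 := by
  rw [← nonpos_iff_eq_zero]
  refine (lintegral_h2oLaw_le _ _ _ _ _ _).trans ?_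
  have hκ : ∀ Doff : Fin T → Round X A H, ∀ i < T, ∀ D,
      h2oKernel alg Mstar d₁ Doff i D Set.univ ≤ 1 := by
    intro Doff i hi D
    rw [h2oKernel_of_le _ _ _ _ hi.le]
    simp
  have hvm : Measurable fun s : Round X A H => (Mstar h).vanishing (s h) :=
    (Mstar h).measurable_vanishing.comp (measurable_pi_apply h)
  calc _ ≤ ∫⁻ Doff : Fin T → Round X A H, ∑ i, (Mstar h).vanishing (Doff i h)
        ∂(Measure.pi fun _ : Fin T => q) := by
        refine lintegral_mono fun Doff => ?_
        simp only
        rw [lintegral_add_left measurable_const, lintegral_const,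
          lintegral_iterLaw_sum_eq_zero (h2oKernel alg Mstar d₁ Doff)
            (fun s => (Mstar h).vanishing (s h)) T hvm (hκ Doff) (fun i hi D => ?_), add_zero]
        · refine mul_le_of_le_one_right' ?_
          have := lintegral_iterLaw_prod_le_one (h2oKernel alg Mstar d₁ Doff) (fun _ _ _ => 1) T
            (fun _ _ _ => measurable_const) (fun i hi D => by simpa using hκ Doff i hi D)
          simpa using this
        · rw [h2oKernel_of_le _ _ _ _ hi.le]
          exact (hasSampleLaw_trajLaw Mstar d₁ _ h).lintegral_vanishing
    _ = ∑ i, ∫⁻ Doff : Fin T → Round X A H, (Mstar h).vanishing (Doff i h)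
        ∂(Measure.pi fun _ : Fin T => q) :=
        lintegral_finsetSum _ fun i _ => hvm.comp (measurable_pi_apply i)
    _ = 0 := by
        refine Finset.sum_eq_zero fun i _ => ?_
        refine ((measurePreserving_eval (fun _ : Fin T => q) i).lintegral_comp hvm).trans ?_
        exact (hasSampleLaw_of_map_eq (measurable_pi_apply h) (hq h)).lintegral_vanishing
    _ ≤ 0 := le_rfl

/-- Accumulated squared Hellinger error on the data of H₂O after `t` iterations. -/
def h2oGain (alg : OfflineAlg X A H) (Mstar : Model X A ρ H) (d₁ : PMF X)
    (ν : Fin H → PMF (X × A)) {T t : ℕ} (ht : t ≤ T)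
    (ω : (Fin T → Round X A H) × (Fin T → Round X A H)) (h : Fin H) (m : LayerModel X A ρ) :
    ℝ≥0∞ :=
  ∑ j : Fin t ⊕ Fin t, hellGain (Sum.elim (fun _ => ⇑(ν h)) (fun i : Fin t => occupancy Mstar d₁
    (h2oPolicy alg ω.1 (i.isLt.le.trans ht) (firstElems ω.2 i (i.isLt.le.trans ht))) h) j)
      m (Mstar h)

theorem measurable_h2oPolicy
    (halg : ∀ (n : ℕ) (φ : Policy X A H → ℝ≥0∞), Measurable fun D => φ (alg n D))
    {T i : ℕ} (hi : i ≤ T) (φ : Policy X A H → ℝ≥0∞) :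
    Measurable fun ω : (Fin T → Round X A H) × (Fin T → Round X A H) =>
      φ (h2oPolicy alg ω.1 hi (firstElems ω.2 i hi)) :=
  (halg (i + i) φ).comp (measurable_h2oData hi)

theorem measurable_h2oPolicy_right
    (halg : ∀ (n : ℕ) (φ : Policy X A H → ℝ≥0∞), Measurable fun D => φ (alg n D))
    {T i : ℕ} (hi : i ≤ T) (φ : Policy X A H → ℝ≥0∞) (Doff : Fin T → Round X A H) :
    Measurable fun Don : Fin T → Round X A H =>
      φ (h2oPolicy alg Doff hi (firstElems Don i hi)) :=
  (measurable_h2oPolicy halg hi φ).comp (measurable_prodMk_left (x := Doff))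

theorem h2oLaw_measure_le
    (halg : ∀ (n : ℕ) (φ : Policy X A H → ℝ≥0∞), Measurable fun D => φ (alg n D))
    (hq : ∀ h, q.map (fun s => s h) = sampleLaw (ν h) (Mstar h)) {T t : ℕ} (ht : t ≤ T)
    (h : Fin H) (m : LayerModel X A ρ) (L : ℝ) :
    h2oLaw alg Mstar d₁ q T {ω | ∏ i, (Mstar h).sampleDens (h2oData ω ht i h) ≤
        ∏ i, m.sampleDens (h2oData ω ht i h) ∧
      ENNReal.ofReal L < h2oGain alg Mstar d₁ ν ht ω h m} ≤ ENNReal.ofReal (Real.exp (-L)) := by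
  have hcast : ∀ i : Fin T, Measurable
      fun ω : (Fin T → Round X A H) × (Fin T → Round X A H) => ω.1 i h := fun i =>
    (measurable_pi_apply h).comp ((measurable_pi_apply i).comp measurable_fst)
  have hcast' : ∀ i : Fin T, Measurable
      fun ω : (Fin T → Round X A H) × (Fin T → Round X A H) => ω.2 i h := fun i =>
    (measurable_pi_apply h).comp ((measurable_pi_apply i).comp measurable_snd)
  simp_rw [prod_sampleDens_h2oData]
  refine measure_prod_le_and_lt_sum_le (h2oLaw alg Mstar d₁ q T) (fun _ : Fin t ⊕ Fin t => m)
    (fun _ => Mstar h)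
    (fun j ω => Sum.elim (fun i => ω.1 (Fin.castLE ht i) h) (fun i => ω.2 (Fin.castLE ht i) h) j)
    (fun j ω => hellGain (Sum.elim (fun _ => ⇑(ν h)) (fun i : Fin t => occupancy Mstar d₁
      (h2oPolicy alg ω.1 (i.isLt.le.trans ht) (firstElems ω.2 i (i.isLt.le.trans ht))) h) j)
        m (Mstar h)) ?_ ?_ ?_ ?_ ?_ L
  · rintro (i | i) ω
    · exact hellGain_ne_top (PMF.tsum_coe _) _ _
    · exact hellGain_ne_top (tsum_occupancy _ _ _ _) _ _
  · rintro (i | i)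
    · exact hcast _
    · exact hcast' _
  · rintro (i | i)
    · simp only [Sum.elim_inl]
      exact measurable_const
    · exact measurable_h2oPolicy halg (i.isLt.le.trans ht)
        fun π => hellGain (occupancy Mstar d₁ π h) m (Mstar h)
  · rw [← nonpos_iff_eq_zero]
    refine le_trans (lintegral_mono fun ω => ?_) (lintegral_h2oLaw_vanishing hq T h).le
    simp only [Fintype.sum_sum_type, Sum.elim_inl, Sum.elim_inr]
    rw [sum_castLE_eq ht fun i => (Mstar h).vanishing (ω.1 i h),
      sum_castLE_eq ht fun i => (Mstar h).vanishing (ω.2 i h)]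
    refine add_le_add (Finset.sum_le_sum fun i _ => ?_) (Finset.sum_le_sum fun i _ => ?_) <;>
    · split_ifs
      · exact le_rfl
      · exact zero_le
  · refine (lintegral_h2oLaw_le _ _ _ _ _ _).trans ?_
    simp only [Fintype.prod_sum_type, Sum.elim_inl, Sum.elim_inr]
    have hrm : Measurable fun s : Round X A H => sqrtLikRatio m (Mstar h) (s h) :=
      (measurable_sqrtLikRatio _ _).comp (measurable_pi_apply h)
    have hon : ∀ Doff : Fin T → Round X A H, ∫⁻ Don : Fin T → Round X A H,
        ∏ i : Fin t, (sqrtLikRatio m (Mstar h) (Don (Fin.castLE ht i) h) *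
          expENN (hellGain (occupancy Mstar d₁ (h2oPolicy alg Doff (i.isLt.le.trans ht)
            (firstElems Don i (i.isLt.le.trans ht))) h) m (Mstar h)))
        ∂(iterLaw (h2oKernel alg Mstar d₁ Doff) T) ≤ 1 := by
      intro Doff
      have := lintegral_iterLaw_prod_castLE_le_one (h2oKernel alg Mstar d₁ Doff)
        (fun i D s => if hi : i ≤ T then sqrtLikRatio m (Mstar h) (s h) *
          expENN (hellGain (occupancy Mstar d₁ (h2oPolicy alg Doff hi D) h) m (Mstar h)) else 0) ht
        (fun i hi D => by rw [h2oKernel_of_le _ _ _ _ hi.le]; simp)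
        (fun i hi D => by
          simp only [hi.le.trans ht, dif_pos]
          exact hrm.mul_const _)
        (fun i hi D => by
          simp only [hi.le.trans ht, dif_pos]
          rw [h2oKernel_of_le _ _ _ _ (hi.le.trans ht), lintegral_mul_const _ hrm]
          exact (hasSampleLaw_trajLaw Mstar d₁ _ h).lintegral_mul_expENN_le
            (tsum_occupancy _ _ _ _) m)
      refine le_trans (le_of_eq (lintegral_congr fun D => Finset.prod_congr rfl fun i _ => ?_)) this
      rw [dif_pos (i.isLt.le.trans ht)]
    have hmon : ∀ Doff : Fin T → Round X A H, Measurable fun Don : Fin T → Round X A H =>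
        ∏ i : Fin t, (sqrtLikRatio m (Mstar h) (Don (Fin.castLE ht i) h) *
          expENN (hellGain (occupancy Mstar d₁ (h2oPolicy alg Doff (i.isLt.le.trans ht)
            (firstElems Don i (i.isLt.le.trans ht))) h) m (Mstar h))) := by
      intro Doff
      refine Finset.measurable_prod _ fun i _ => ?_
      have h1 : Measurable fun Don : Fin T → Round X A H => hellGain (occupancy Mstar d₁
          (h2oPolicy alg Doff (i.isLt.le.trans ht) (firstElems Don i (i.isLt.le.trans ht))) h)
            m (Mstar h) :=
        measurable_h2oPolicy_right halg (i.isLt.le.trans ht)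
          (fun π => hellGain (occupancy Mstar d₁ π h) m (Mstar h)) Doff
      have h2 : Measurable fun Don : Fin T → Round X A H =>
          sqrtLikRatio m (Mstar h) (Don (Fin.castLE ht i) h) :=
        hrm.comp (measurable_pi_apply (Fin.castLE ht i))
      exact h2.mul (measurable_expENN.comp h1)
    calc _ ≤ ∫⁻ Doff : Fin T → Round X A H, ∏ i : Fin t,
          (sqrtLikRatio m (Mstar h) (Doff (Fin.castLE ht i) h) *
            expENN (hellGain (ν h) m (Mstar h))) ∂(Measure.pi fun _ : Fin T => q) := by
          refine lintegral_mono fun Doff => ?_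
          simp only
          rw [lintegral_const_mul _ (hmon Doff)]
          exact mul_le_of_le_one_right' (hon Doff)
      _ ≤ 1 := by
          refine lintegral_pi_prod_castLE_le_one q (g := fun s => sqrtLikRatio m (Mstar h) (s h) *
            expENN (hellGain (ν h) m (Mstar h))) (hrm.mul_const _) ?_ ht
          rw [lintegral_mul_const _ hrm]
          exact (hasSampleLaw_of_map_eq (measurable_pi_apply h) (hq h)).lintegral_mul_expENN_le
            (PMF.tsum_coe _) m

end MDP

end

noncomputable section

theorem ofReal_sum_le_sum_ofReal {ι : Type*} (s : Finset ι) (f : ι → ℝ) :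
    ENNReal.ofReal (∑ i ∈ s, f i) ≤ ∑ i ∈ s, ENNReal.ofReal (f i) := by
  induction s using Finset.cons_induction with
  | empty => simp
  | cons a s ha ih =>
    rw [Finset.sum_cons, Finset.sum_cons]
    exact ENNReal.ofReal_add_le.trans (add_le_add le_rfl ih)

/-- Tuning of the scale in the regret bound. -/
theorem div_le_of_forall_scale {S T L G Cs Cc ℓ : ℝ} {H : ℕ} (hH : 0 < H) (hT : 0 < T)
    (hL : 1 / 4 ≤ L) (hG : 1 ≤ G) (hCs : Cs ≤ G) (hCc : Cc ≤ G)
    (hℓ : 0 ≤ ℓ) (hST : S ≤ T)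
    (hS : ∀ γ : ℝ, 0 < γ →
      S ≤ H * (4 * ((1 + Cs / γ * (1 + ℓ)) + Cc * (2 + 2 / γ * ℓ)) + 4 * γ * T * L)) :
    S / T ≤ 40 * (1 + ℓ) * (H * √(G * L / T)) := by
  have hH' : (1 : ℝ) ≤ H := by exact_mod_cast hH
  set r := √(G * L / T) with hr
  have hx : 0 < G * L / T := by positivity
  have hr0 : 0 < r := Real.sqrt_pos.2 hx
  have hr2 : r ^ 2 = G * L / T := Real.sq_sqrt hx.le
  have h1ℓ : 1 ≤ 1 + ℓ := by linarith
  rcases lt_or_ge T G with hTG | hTG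
  · have hle : S / T ≤ 1 := (div_le_one hT).2 hST
    have hhalf : 1 / 2 ≤ r := by
      refine Real.le_sqrt_of_sq_le ?_
      rw [le_div_iff₀ hT]
      nlinarith
    have : (1 : ℝ) / 2 ≤ (1 + ℓ) * (H * r) := by
      calc (1 : ℝ) / 2 ≤ 1 * (1 * r) := by linarith
        _ ≤ _ := by gcongr
    linarith
  · have hγ : 0 < G / (T * r) := by positivity
    have key := hS _ hγ
    have e1 : ∀ c : ℝ, c / (G / (T * r)) = c / G * (T * r) := fun c => by field_simp
    have e2 : 4 * (G / (T * r)) * T * L = 4 * (T * r) := by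
      have : G * L = r ^ 2 * T := by rw [hr2]; field_simp
      calc 4 * (G / (T * r)) * T * L = 4 * (G * L) / r := by field_simp
        _ = _ := by rw [this]; field_simp
    rw [e1, e1, e2] at key
    have hG0 : 0 < G := by linarith
    have hTr : 0 < T * r := by positivity
    have hCsG : Cs / G ≤ 1 := (div_le_one hG0).2 hCs
    have hCcG : Cc / G ≤ 1 := (div_le_one hG0).2 hCc
    have b1 : Cs / G * (T * r) * (1 + ℓ) ≤ T * r * (1 + ℓ) := by
      calc _ ≤ 1 * (T * r) * (1 + ℓ) := by gcongr
        _ = _ := by ring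
    have b2 : Cc * (2 / G * (T * r) * ℓ) ≤ 2 * (T * r) * (1 + ℓ) := by
      calc Cc * (2 / G * (T * r) * ℓ) = (Cc / G) * (2 * (T * r) * ℓ) := by ring
        _ ≤ 1 * (2 * (T * r) * (1 + ℓ)) := by
          gcongr
          linarith
        _ = _ := by ring
    have b3 : G ≤ 2 * (T * r) := by
      have : G / T ≤ 2 * r := by
        refine abs_le_of_sq_le_sq' ?_ (by positivity) |>.2
        have h1 : G / T ≤ 1 := (div_le_one hT).2 hTG
        have h0 : 0 ≤ G / T := by positivity
        rw [mul_pow, hr2, mul_div_right_comm]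
        nlinarith
      rw [div_le_iff₀ hT] at this
      linarith
    have b4 : T * r ≤ T * r * (1 + ℓ) := le_mul_of_one_le_right hTr.le h1ℓ
    have hin : 4 * ((1 + Cs / G * (T * r) * (1 + ℓ)) + Cc * (2 + 2 / G * (T * r) * ℓ)) +
        4 * (T * r) ≤ 40 * (T * r * (1 + ℓ)) := by
      rw [mul_add Cc]
      linarith
    rw [div_le_iff₀ hT]
    calc S ≤ H * (40 * (T * r * (1 + ℓ))) := key.trans (by gcongr)
      _ = _ := by ring

section MDP

variable {X A : Type*} [MeasurableSpace X] [MeasurableSpace A] {ρ : Measure ℝ}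
variable [Countable X] [DiscreteMeasurableSpace X] [Countable A] [DiscreteMeasurableSpace A]
variable {H : ℕ} {Mstar : Model X A ρ H} {d₁ : PMF X}
variable {𝓜 : Fin H → Finset (LayerModel X A ρ)} {optPol : Model X A ρ H → DetPolicy X A H}
  {πstar : DetPolicy X A H} {est : (n : ℕ) → (Fin n → Round X A H) → Model X A ρ H} {δ : ℝ}

/-! ### Risk of H₂O -/

theorem finite_modelSet (𝓜 : Fin H → Finset (LayerModel X A ρ)) : (modelSet 𝓜).Finite := by
  classical
  have hset : modelSet 𝓜 = ↑(Fintype.piFinset 𝓜) := by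
    ext M
    simp [modelSet]
  rw [hset]
  exact Finset.finite_toSet _

theorem IsMLERule.mem_modelSet (hest : IsMLERule 𝓜 est) (n : ℕ) (D : Fin n → Round X A H) :
    est n D ∈ modelSet 𝓜 := fun h => (hest.1 n D h).1

theorem IsMLERule.measurable_comp (hest : IsMLERule 𝓜 est) (n : ℕ)
    (φ : Model X A ρ H → ℝ≥0∞) : Measurable fun D => φ (est n D) := by
  intro s _
  have : (fun D => φ (est n D)) ⁻¹' s = ⋃ M ∈ {M ∈ modelSet 𝓜 | φ M ∈ s}, {D | est n D = M} := by
    ext D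
    simp only [Set.mem_preimage, Set.mem_iUnion, exists_prop]
    constructor
    · exact fun hD => ⟨est n D, ⟨hest.mem_modelSet n D, hD⟩, rfl⟩
    · rintro ⟨M, ⟨_, hM⟩, hD⟩
      have hD' : est n D = M := hD
      rw [hD']
      exact hM
  rw [this]
  exact ((finite_modelSet 𝓜).subset fun M hM => hM.1).measurableSet_biUnion
    fun M _ => hest.2 n M

/-- The sequence of models estimated in a run of H₂O. -/
def h2oModel (est : (n : ℕ) → (Fin n → Round X A H) → Model X A ρ H) (Mstar : Model X A ρ H)
    {T : ℕ} (ω : (Fin T → Round X A H) × (Fin T → Round X A H)) (t : ℕ) : Model X A ρ H :=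
  if ht : t ≤ T then est (t + t) (h2oData ω ht) else Mstar

theorem h2oPolicy_mleAlg {T : ℕ} (ω : (Fin T → Round X A H) × (Fin T → Round X A H)) {t : ℕ}
    (ht : t ≤ T) : h2oPolicy (mleAlg est optPol) ω.1 ht (firstElems ω.2 t ht) =
      (optPol (h2oModel est Mstar ω t)).toPolicy := by
  rw [h2oModel, dif_pos ht]
  rfl

theorem h2oModel_mem (hest : IsMLERule 𝓜 est) (hMstar : Mstar ∈ modelSet 𝓜) {T : ℕ}
    (ω : (Fin T → Round X A H) × (Fin T → Round X A H)) (t : ℕ) :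
    h2oModel est Mstar ω t ∈ modelSet 𝓜 := by
  unfold h2oModel
  split_ifs
  · exact hest.mem_modelSet _ _
  · exact hMstar

theorem h2oRisk_mleAlg {T : ℕ} (ω : (Fin T → Round X A H) × (Fin T → Round X A H)) :
    h2oRisk (mleAlg est optPol) Mstar d₁ πstar ω =
      (∑ t ∈ Finset.range T, (expReward Mstar d₁ πstar.toPolicy -
        expReward Mstar d₁ (optPol (h2oModel est Mstar ω t)).toPolicy)) / T := by
  rw [h2oRisk, Finset.sum_range]
  simp_rw [fun t : Fin T => h2oPolicy_mleAlg (est := est) (optPol := optPol) (Mstar := Mstar) ω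
    t.isLt.le]

theorem two_mul_h2oGain {ν : Fin H → PMF (X × A)} {T t : ℕ} (ht : t ≤ T)
    (ω : (Fin T → Round X A H) × (Fin T → Round X A H)) (h : Fin H) (m : LayerModel X A ρ) :
    2 * h2oGain (mleAlg est optPol) Mstar d₁ ν ht ω h m =
      ∑' z, ((t : ℝ≥0∞) * ν h z + ∑ s ∈ Finset.range t,
        occupancy Mstar d₁ (optPol (h2oModel est Mstar ω s)).toPolicy h z) *
          hellSq m (Mstar h) z := by
  rw [h2oGain, two_mul_sum_hellGain]
  refine tsum_congr fun z => ?_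
  congr 1
  rw [Fintype.sum_sum_type, Finset.sum_range]
  simp only [Sum.elim_inl, Sum.elim_inr, Finset.sum_const, Finset.card_univ, Fintype.card_fin,
    nsmul_eq_mul]
  congr 1
  refine Finset.sum_congr rfl fun i _ => ?_
  rw [h2oPolicy_mleAlg]

theorem SinglePolicyConc.one_le {π : Policy X A H} {ν : Fin H → PMF (X × A)} {C : ℝ≥0}
    (hH : 0 < H) (hν : SinglePolicyConc Mstar d₁ π ν C) : 1 ≤ C := by
  have : (1 : ℝ≥0∞) ≤ C := by
    rw [← tsum_occupancy Mstar d₁ π ⟨0, hH⟩]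
    calc _ ≤ ∑' z, (C : ℝ≥0∞) * ν ⟨0, hH⟩ z := ENNReal.tsum_le_tsum fun z =>
          le_mul_of_densRatio_le (PMF.apply_ne_top _ _) (hν _ z)
      _ = C := by rw [ENNReal.tsum_mul_left, PMF.tsum_coe, mul_one]
  exact_mod_cast this

theorem exists_covering_of_coverability {Pi : Set (Policy X A H)} {C : ℝ≥0}
    (hC : coverability Mstar d₁ Pi = C) :
    ∃ μ : Fin H → PMF (X × A), ∀ π ∈ Pi, ∀ h z,
      occupancy Mstar d₁ π h z ≤ ((C + 1 : ℝ≥0) : ℝ≥0∞) * μ h z := by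
  have hlt : coverability Mstar d₁ Pi < ((C + 1 : ℝ≥0) : ℝ≥0∞) := by
    rw [hC]
    exact_mod_cast lt_add_one C
  obtain ⟨μ, hμ⟩ := iInf_lt_iff.1 hlt
  refine ⟨μ, fun π hπ h z => le_mul_of_densRatio_le (PMF.apply_ne_top _ _) (le_trans ?_ hμ.le)⟩
  exact le_iSup₂_of_le π hπ (le_iSup₂_of_le h z le_rfl)

/-- The risk bound on the event that the estimated models are accurate. -/
theorem h2oRisk_le_of_gain_le (hH : 0 < H) (hnorm : ∀ M ∈ modelSet 𝓜, NormalizedRewards M)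
    (hopt : ∀ M ∈ modelSet 𝓜, IsOptimalFor M (optPol M)) (hest : IsMLERule 𝓜 est)
    (hMstar : Mstar ∈ modelSet 𝓜) {T : ℕ} {ν : Fin H → PMF (X × A)} {Cstar Ccov : ℝ≥0}
    (hT : 0 < T) (hν : SinglePolicyConc Mstar d₁ πstar.toPolicy ν Cstar)
    (hcov : coverability Mstar d₁ (inducedPolicies 𝓜 optPol) = Ccov) {L : ℝ} (hL : 1 / 4 ≤ L)
    (ω : (Fin T → Round X A H) × (Fin T → Round X A H))
    (hgain : ∀ t (ht : t < T) (h : Fin H), h2oGain (mleAlg est optPol) Mstar d₁ ν ht.le ω h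
      (h2oModel est Mstar ω t h) ≤ ENNReal.ofReal L) :
    h2oRisk (mleAlg est optPol) Mstar d₁ πstar ω ≤
      40 * (1 + Real.log T) * (H * √((Cstar + Ccov) * L / T)) := by
  have hmem := h2oModel_mem (est := est) hest hMstar ω
  obtain ⟨μ, hμ⟩ := exists_covering_of_coverability hcov
  have hCs1 := hν.one_le hH
  have hT' : (0 : ℝ) < T := by exact_mod_cast hT
  have hCs1' : (1 : ℝ) ≤ Cstar := by exact_mod_cast hCs1
  have hCc0 := Ccov.coe_nonneg
  have hlogT : 0 ≤ Real.log T := Real.log_natCast_nonneg T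
  rw [h2oRisk_mleAlg]
  refine div_le_of_forall_scale (Cs := Cstar) (Cc := (Ccov + 1 : ℝ≥0)) hH hT' hL
    (by linarith) (by linarith) (by push_cast; linarith)
    hlogT ?_ fun γ hγ => ?_
  · calc _ ≤ ∑ t ∈ Finset.range T, (1 : ℝ) := Finset.sum_le_sum fun t _ => by
          have h1 := ((hnorm _ hMstar).expReward_mem_Icc d₁ πstar.toPolicy).2
          have h2 := ((hnorm _ hMstar).expReward_mem_Icc d₁
            (optPol (h2oModel est Mstar ω t)).toPolicy).1
          linarith
      _ = T := by simp
  · lift γ to ℝ≥0 using hγ.le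
    have hL0 : 0 ≤ L := by linarith
    have key := sum_ofReal_gap_le (hnorm _ hMstar) d₁ (πstar := πstar.toPolicy)
      (M := h2oModel est Mstar ω) (fun t => hnorm _ (hmem t))
      (π := fun t => optPol (h2oModel est Mstar ω t)) (fun t => hopt _ (hmem t)) ν μ
      (Cs := Cstar) (Cc := Ccov + 1) (γ := γ) hγ
      (fun h z => le_mul_of_densRatio_le (PMF.apply_ne_top _ _) (hν h z))
      (fun t h z => hμ _ ⟨_, hmem t, rfl⟩ h z) hT hL0
      (fun t ht h => by
        rw [← two_mul_h2oGain ht.le]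
        exact mul_le_mul' le_rfl (hgain t ht h))
    have hnn : 0 ≤ (H : ℝ) * (4 * ((1 + Cstar / γ * (1 + Real.log T)) +
        (Ccov + 1 : ℝ≥0) * (2 + 2 / γ * Real.log T)) + 4 * γ * T * L) := by positivity
    refine (ENNReal.ofReal_le_ofReal_iff hnn).1 (le_trans ?_ key)
    exact ofReal_sum_le_sum_ofReal _ _

/-- With a single model per layer, H₂O has no risk. -/
theorem h2oRisk_nonpos_of_maxLayerModels_le_one
    (hnorm : ∀ M ∈ modelSet 𝓜, NormalizedRewards M)
    (hopt : ∀ M ∈ modelSet 𝓜, IsOptimalFor M (optPol M)) (hest : IsMLERule 𝓜 est)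
    (hMstar : Mstar ∈ modelSet 𝓜) (hN : maxLayerModels 𝓜 ≤ 1) {T : ℕ}
    (ω : (Fin T → Round X A H) × (Fin T → Round X A H)) :
    h2oRisk (mleAlg est optPol) Mstar d₁ πstar ω ≤ 0 := by
  have huniq : ∀ M ∈ modelSet 𝓜, M = Mstar := fun M hM => funext fun h =>
    Finset.card_le_one.1 ((card_le_maxLayerModels 𝓜 h).trans hN) _ (hM h) _ (hMstar h)
  rw [h2oRisk_mleAlg]
  refine div_nonpos_of_nonpos_of_nonneg (Finset.sum_nonpos fun t _ => ?_) (Nat.cast_nonneg _)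
  rw [huniq _ (h2oModel_mem hest hMstar ω t), sub_nonpos, (hnorm _ hMstar).expReward_eq,
    (hnorm _ hMstar).expReward_eq]
  exact ENNReal.toReal_mono
    (((hnorm _ hMstar).truncReturn_le_one _ _).trans_lt ENNReal.one_lt_top).ne
    ((hopt _ hMstar).truncReturn_le (hnorm _ hMstar) d₁ _)

theorem quarter_le_log_maxLayerModels (hH : 0 < H) (hδ : 0 < δ) (hδ1 : δ < 1)
    (hN : 1 < maxLayerModels 𝓜) : 1 / 4 ≤ Real.log (maxLayerModels 𝓜 * H / δ) := by
  have hN' : (2 : ℝ) ≤ maxLayerModels 𝓜 := by exact_mod_cast hN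
  have hH' : (1 : ℝ) ≤ H := by exact_mod_cast hH
  have h2 : (2 : ℝ) ≤ maxLayerModels 𝓜 * H / δ := by
    rw [le_div_iff₀ hδ]
    nlinarith
  have := Real.log_le_log two_pos h2
  linarith [Real.log_two_gt_d9]

theorem h2oLaw_risk_le (hH : 0 < H) (hnorm : ∀ M ∈ modelSet 𝓜, NormalizedRewards M)
    (hopt : ∀ M ∈ modelSet 𝓜, IsOptimalFor M (optPol M)) (hest : IsMLERule 𝓜 est)
    (hδ : 0 < δ) (hδ1 : δ < 1) (hMstar : Mstar ∈ modelSet 𝓜) {T : ℕ} {ν : Fin H → PMF (X × A)}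
    {q : Measure (Round X A H)} [IsProbabilityMeasure q] {Cstar Ccov : ℝ≥0} (hT : 0 < T)
    (hq : ∀ h, q.map (fun s => s h) = sampleLaw (ν h) (Mstar h))
    (hν : SinglePolicyConc Mstar d₁ πstar.toPolicy ν Cstar)
    (hcov : coverability Mstar d₁ (inducedPolicies 𝓜 optPol) = Ccov) :
    h2oLaw (mleAlg est optPol) Mstar d₁ q T
        {D | ¬ h2oRisk (mleAlg est optPol) Mstar d₁ πstar D ≤
          40 * (1 + Real.log T) ^ 1 *
            (H * √((Cstar + Ccov) * Real.log (maxLayerModels 𝓜 * H / δ) / T))}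
      ≤ ENNReal.ofReal (δ * T) := by
  rcases le_or_gt (maxLayerModels 𝓜) 1 with hN | hN
  · have hempty : ∀ D : (Fin T → Round X A H) × (Fin T → Round X A H),
        h2oRisk (mleAlg est optPol) Mstar d₁ πstar D ≤
        40 * (1 + Real.log T) ^ 1 *
          (H * √((Cstar + Ccov) * Real.log (maxLayerModels 𝓜 * H / δ) / T)) := by
      intro D
      refine (h2oRisk_nonpos_of_maxLayerModels_le_one hnorm hopt hest hMstar hN D).trans ?_
      have := Real.log_natCast_nonneg T
      positivity
    refine (measure_mono (t := ∅) fun D hD => (hD (hempty D)).elim).trans ?_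
    simp
  have halg : ∀ (n : ℕ) (φ : Policy X A H → ℝ≥0∞),
      Measurable fun D => φ (mleAlg est optPol n D) := fun n φ =>
    hest.measurable_comp n fun M => φ (optPol M).toPolicy
  set L := Real.log (maxLayerModels 𝓜 * H / δ) with hLdef
  set E : Fin T → Fin H → LayerModel X A ρ →
      Set ((Fin T → Round X A H) × (Fin T → Round X A H)) := fun t h m =>
    {ω | ∏ i, (Mstar h).sampleDens (h2oData ω t.isLt.le i h) ≤
        ∏ i, m.sampleDens (h2oData ω t.isLt.le i h) ∧
      ENNReal.ofReal L < h2oGain (mleAlg est optPol) Mstar d₁ ν t.isLt.le ω h m} with hE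
  calc _ ≤ h2oLaw (mleAlg est optPol) Mstar d₁ q T (⋃ t, ⋃ h, ⋃ m ∈ 𝓜 h, E t h m) := by
        refine measure_mono fun ω hω => ?_
        by_contra hcon
        refine hω ?_
        rw [pow_one]
        refine h2oRisk_le_of_gain_le hH hnorm hopt hest hMstar hT hν hcov
          (quarter_le_log_maxLayerModels hH hδ hδ1 hN) ω fun t ht h => ?_
        by_contra hlt
        refine hcon (Set.mem_iUnion.2 ⟨⟨t, ht⟩, Set.mem_iUnion.2 ⟨h, Set.mem_biUnion
          (h2oModel_mem hest hMstar ω t h) ⟨?_, not_le.1 hlt⟩⟩⟩)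
        have e : h2oModel est Mstar ω t = est (t + t) (h2oData ω ht.le) := dif_pos ht.le
        rw [e]
        exact (hest.1 _ _).prod_sampleDens_le (hMstar h)
    _ ≤ ∑ t : Fin T, h2oLaw (mleAlg est optPol) Mstar d₁ q T (⋃ h, ⋃ m ∈ 𝓜 h, E t h m) :=
        measure_iUnion_fintype_le _ _
    _ ≤ ∑ t : Fin T, ENNReal.ofReal δ := Finset.sum_le_sum fun t _ =>
        measure_exists_layer_le _ 𝓜 (fun h => ⟨_, hMstar h⟩) hH hδ _ fun h m _ =>
          h2oLaw_measure_le halg hq t.isLt.le h m L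
    _ = ENNReal.ofReal (δ * T) := by
        rw [Finset.sum_const, nsmul_eq_mul, Finset.card_univ, Fintype.card_fin, mul_comm,
          ENNReal.ofReal_mul hδ.le, ENNReal.ofReal_natCast]

end MDP

end

theorem mainTheorem7 :
    ∃ (C : ℝ) (k : ℕ), 0 < C ∧
    ∀ (X : Type*) (A : Type*) [Countable X] [Countable A]
      [MeasurableSpace X] [DiscreteMeasurableSpace X]
      [MeasurableSpace A] [DiscreteMeasurableSpace A]
      (ρ : Measure ℝ) [SigmaFinite ρ] (H : ℕ) (d₁ : PMF X)
      (𝓜 : Fin H → Finset (LayerModel X A ρ)) (Mstar : Model X A ρ H)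
      (optPol : Model X A ρ H → DetPolicy X A H) (πstar : DetPolicy X A H)
      (est : (n : ℕ) → (Fin n → Round X A H) → Model X A ρ H) (δ : ℝ),
      0 < H →
      (∀ M ∈ modelSet 𝓜, NormalizedRewards M) →
      (∀ M ∈ modelSet 𝓜, IsOptimalFor M (optPol M)) →
      IsOptimalFor Mstar πstar →
      IsMLERule 𝓜 est →
      0 < δ → δ < 1 →
      Mstar ∈ modelSet 𝓜 →
      -- CC-boundedness when the samples of a round are independent across the layers
      CCBounded (mleAlg est optPol) Mstar d₁ πstar (fun S => S.LayerIndependent) δ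
          (fun γ => 6 / γ) (fun γ => 8 * Real.log (numModels 𝓜 * H / δ) * γ) ∧
      -- CC-boundedness when the samples of a round are arbitrarily dependent across the layers:
      -- the second scaling function then enters once for every layer
      CCBounded (mleAlg est optPol) Mstar d₁ πstar (fun _ => True) δ
          (fun γ => 6 / γ) (fun γ => H * (8 * Real.log (maxLayerModels 𝓜 * H / δ) * γ)) ∧
      -- risk of H₂O run with model-based MLE
      ∀ (T : ℕ) (ν : Fin H → PMF (X × A)) (q : Measure (Round X A H)) (Cstar Ccov : ℝ≥0),
        0 < T →
        IsProbabilityMeasure q →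
        (∀ h, q.map (fun s => s h) = sampleLaw (ν h) (Mstar h)) →
        SinglePolicyConc Mstar d₁ πstar.toPolicy ν Cstar →
        coverability Mstar d₁ (inducedPolicies 𝓜 optPol) = Ccov →
        h2oLaw (mleAlg est optPol) Mstar d₁ q T
            {D | ¬ h2oRisk (mleAlg est optPol) Mstar d₁ πstar D ≤
              C * (1 + Real.log T) ^ k *
                (H * √((Cstar + Ccov) * Real.log (maxLayerModels 𝓜 * H / δ) / T))}
          ≤ ENNReal.ofReal (δ * T) := by
  refine ⟨40, 1, by norm_num, ?_⟩
  intro X A _ _ _ _ _ _ ρ _ H d₁ 𝓜 Mstar optPol πstar est δ hH hnorm hopt _ hest hδ hδ1 hMstar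
  refine ⟨ccBounded_mleAlg_of_layerIndependent d₁ hH hnorm hopt hest hδ hδ1 hMstar,
    ccBounded_mleAlg d₁ hH hnorm hopt hest hδ hδ1 hMstar, ?_⟩
  intro T ν q Cstar Ccov hT _ hq hν hcov
  exact h2oLaw_risk_le hH hnorm hopt hest hδ hδ1 hMstar hT hq hν hcov
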